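/- Let $d\in\{2,3\}$ and let $\Omega\subset\mathbb R^d$ be a nonempty bounded open set (for instance a bounded Lipschitz domain). Let $\mathcal V$ be the space of divergence-free $C^\infty$ vector fields with compact support in $\Omega$, let $H$ and $V$ be the closures of $\mathcal V$ in $L^2(\Omega)^d$ and in $H^1(\Omega)^d$, with $\|v\|_H=\|v\|_{L^2(\Omega)}$ and $\|v\|_V=\|\nabla v\|_{L^2(\Omega)}$, and let $V'$ be the dual of $V$ with the norm $\|g\|_{V'}=\sup\{|\langle g,v\rangle| : \|v\|_V\le 1\}$. Let $c_\rho>0$ be a constant in the Poincaré inequality, $\|v\|_H\le c_\rho\|v\|_V$ for all $v\in V$ (for example the best one). Let $\nu:(0,\infty)\to\mathbb R$ be integrable on $(0,S)$ for every $S>0$, with $$\underline\nu=\inf_{t>0}\nu(t)>0,\qquad \overline\nu=\sup_{t>0}\nu(t)<\infty,$$ and put $$\phi_s(t)=\int_s^t\nu(z)\,dz,\qquad \bar K=\limsup_{t\to\infty}\int_0^t e^{-\phi_s(t)/c_\rho^2}\,ds .$$ Let $f\in L^2_{\mathrm{loc}}([0,\infty);V')$ and $u_0\in H$, and let $u$ be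 a weak solution on $[0,\infty)$ of the Navier–Stokes equations with viscosity $\nu(t)$, force $f$ and $u(0)=u_0$: for every $S>0$, $u\in L^2(0,S;V)\cap C_w([0,S];H)$ and $du/dt\in L^1_{\mathrm{loc}}((0,S];V')$ (distributional derivative in time, $V\subset H=H'\subset V'$), and for every $v\in V$ $$\Big\langle\frac{du}{dt},v\Big\rangle+\nu(t)\int_\Omega\nabla u:\nabla v\,dx+\int_\Omega((u\cdot\nabla)u)\cdot v\,dx=\langle f,v\rangle\quad\text{for a.e. }t>0 .$$ If $d=3$, assume in addition that $u$ satisfies the (strong) energy inequality: for almost all $0<s<t$, $$\tfrac12\|u(t)\|_H^2+\int_s^t\nu(\tau)\|u(\tau)\|_V^2\,d\tau\le\tfrac12\|u(s)\|_H^2+\int_s^t\langle f(\tau),u(\tau)\rangle\,d\tau .$$ Then for every $T\ge c_\rho^2/\underline\nu$, $$\limsup_{t\to\infty}\frac1T\int_t^{t+T}\|u(\tau)\|_V^2\,d\tau\ \le\ \frac{\bar K\,\underline\nu+c_\rho^2}{\underline\nu^2c_\rho^2}\ \limsup_{t\to\infty}\|f(t)\|_{V'}^2 ,$$ where both sides may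 take the value $+\infty$. -/

import Mathlib

open MeasureTheory Set Filter
open scoped ENNReal ContDiff Topology

noncomputable section

namespace NSE

/-- The Euclidean space `ℝ^d`. -/
abbrev E (d : ℕ) := EuclideanSpace ℝ (Fin d)

/-- `d × d` matrices with the Frobenius (Euclidean) norm; the entry `(i, j)` of a gradient
is `∂_j φ_i`. -/
abbrev G (d : ℕ) := EuclideanSpace ℝ (Fin d × Fin d)

variable {d : ℕ}

/-- The gradient of a vector field: entry `(i, j)` is `∂_j φ_i (x)`. -/
def grad (φ : E d → E d) (x : E d) : G d :=
  WithLp.toLp 2 fun p : Fin d × Fin d => (fderiv ℝ φ x (EuclideanSpace.single p.2 1)) p.1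

/-- The divergence `∑_i ∂_i φ_i`. -/
def divergence (φ : E d → E d) (x : E d) : ℝ := ∑ i, grad φ x (i, i)

/-- The space of divergence free smooth vector fields with compact support in `Ω`. -/
def testFields (Ω : Set (E d)) : Submodule ℝ (E d → E d) where
  carrier := {φ | ContDiff ℝ ∞ φ ∧ HasCompactSupport φ ∧ tsupport φ ⊆ Ω ∧
    ∀ x, divergence φ x = 0}
  zero_mem' := by
    refine ⟨contDiff_const, HasCompactSupport.zero, ?_, fun x => ?_⟩
    · have : tsupport (0 : E d → E d) = ∅ := tsupport_eq_empty_iff.2 rfl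
      rw [this]; exact empty_subset _
    · simp [divergence, grad]
  add_mem' := by
    rintro φ ψ ⟨h1, h2, h3, h4⟩ ⟨k1, k2, k3, k4⟩
    refine ⟨h1.add k1, h2.add k2, (tsupport_add φ ψ).trans (union_subset h3 k3), fun x => ?_⟩
    have e : fderiv ℝ (φ + ψ) x = fderiv ℝ φ x + fderiv ℝ ψ x :=
      fderiv_add (h1.differentiable (by simp) x) (k1.differentiable (by simp) x)
    have a := h4 x
    have b := k4 x
    simp only [divergence, grad] at a b ⊢
    simp [e, Finset.sum_add_distrib, a, b]
  smul_mem' := by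
    rintro c φ ⟨h1, h2, h3, h4⟩
    refine ⟨h1.const_smul c, h2.smul_left (f := fun _ => c), ?_, fun x => ?_⟩
    · exact (tsupport_smul_subset_right (fun _ => c) φ).trans h3
    · have e : fderiv ℝ (c • φ) x = c • fderiv ℝ φ x :=
        fderiv_const_smul (h1.differentiable (by simp) x) c
      have a := h4 x
      simp only [divergence, grad] at a ⊢
      simp [e, ← Finset.mul_sum, a]

/-- `L²(Ω; F)`. -/
abbrev L2 (Ω : Set (E d)) (F : Type) [NormedAddCommGroup F] := Lp F 2 (volume.restrict Ω)

/-- The Hilbert space of pairs (field, gradient field). A field `v` of class `H¹` is recorded as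
the pair `(v, ∇v)`, so that the norm of the pair is the usual `H¹` norm of `v`. -/
abbrev Pairs (Ω : Set (E d)) := WithLp 2 (L2 Ω (E d) × L2 Ω (G d))

/-- The divergence free test fields, as elements of `L²`. -/
def testL2 (Ω : Set (E d)) : Submodule ℝ (L2 Ω (E d)) where
  carrier := {w | ∃ φ ∈ testFields Ω, w =ᵐ[volume.restrict Ω] φ}
  zero_mem' := ⟨0, zero_mem _, Lp.coeFn_zero _ _ _⟩
  add_mem' := by
    rintro w z ⟨φ, hφ, h⟩ ⟨ψ, hψ, k⟩
    exact ⟨φ + ψ, add_mem hφ hψ, (Lp.coeFn_add w z).trans (h.add k)⟩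
  smul_mem' := by
    rintro c w ⟨φ, hφ, h⟩
    exact ⟨c • φ, Submodule.smul_mem _ c hφ, (Lp.coeFn_smul c w).trans (h.const_smul c)⟩

/-- The divergence free test fields, as elements of `H¹`. -/
def testH1 (Ω : Set (E d)) : Submodule ℝ (Pairs Ω) where
  carrier := {w | ∃ φ ∈ testFields Ω,
    w.fst =ᵐ[volume.restrict Ω] φ ∧ w.snd =ᵐ[volume.restrict Ω] grad φ}
  zero_mem' := by
    refine ⟨0, zero_mem _, Lp.coeFn_zero _ _ _, (Lp.coeFn_zero _ _ _).trans ?_⟩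
    refine Eventually.of_forall fun x => ?_
    ext p; simp [grad]
  add_mem' := by
    rintro w z ⟨φ, hφ, h, h'⟩ ⟨ψ, hψ, k, k'⟩
    refine ⟨φ + ψ, add_mem hφ hψ, (Lp.coeFn_add w.fst z.fst).trans (h.add k),
      (Lp.coeFn_add w.snd z.snd).trans ((h'.add k').trans ?_)⟩
    refine Eventually.of_forall fun x => ?_
    have e : fderiv ℝ (φ + ψ) x = fderiv ℝ φ x + fderiv ℝ ψ x :=
      fderiv_add (hφ.1.differentiable (by simp) x) (hψ.1.differentiable (by simp) x)
    ext p; simp [grad, e]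
  smul_mem' := by
    rintro c w ⟨φ, hφ, h, h'⟩
    refine ⟨c • φ, Submodule.smul_mem _ c hφ, (Lp.coeFn_smul c w.fst).trans (h.const_smul c),
      (Lp.coeFn_smul c w.snd).trans ((h'.const_smul c).trans ?_)⟩
    refine Eventually.of_forall fun x => ?_
    have e : fderiv ℝ (c • φ) x = c • fderiv ℝ φ x :=
      fderiv_const_smul (hφ.1.differentiable (by simp) x) c
    ext p; simp [grad, e]

/-- `H`: the closure of the divergence free test fields in `L²(Ω)`. -/
def H (Ω : Set (E d)) : Submodule ℝ (L2 Ω (E d)) := (testL2 Ω).topologicalClosure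

/-- The closure of the divergence free test fields in `H¹`, as a subspace. -/
def VSub (Ω : Set (E d)) : Submodule ℝ (Pairs Ω) := (testH1 Ω).topologicalClosure

/-- `V`: the closure of the divergence free test fields in `H¹`, as a Hilbert space with the
`H¹` inner product. (The equivalent norm `‖·‖_V` is `normV` below.) -/
def V (Ω : Set (E d)) : Type := VSub Ω

instance (Ω : Set (E d)) : NormedAddCommGroup (V Ω) :=
  inferInstanceAs (NormedAddCommGroup (VSub Ω))

instance (Ω : Set (E d)) : InnerProductSpace ℝ (V Ω) :=
  inferInstanceAs (InnerProductSpace ℝ (VSub Ω))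

instance (Ω : Set (E d)) : CompleteSpace (V Ω) :=
  (Submodule.isClosed_topologicalClosure (testH1 Ω)).completeSpace_coe

/-- The dual space `V'`. -/
abbrev V' (Ω : Set (E d)) := StrongDual ℝ (V Ω)

variable {Ω : Set (E d)}

/-- The field underlying an element of `V`, as an element of `L²(Ω)`. -/
def field (v : V Ω) : L2 Ω (E d) := v.1.fst

/-- The weak gradient of an element of `V`. -/
def gradient (v : V Ω) : L2 Ω (G d) := v.1.snd

/-- `‖v‖_H = ‖v‖_{L²(Ω)}`. -/
def normH (v : V Ω) : ℝ := ‖field v‖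

/-- `‖v‖_V = |v|_{H¹(Ω)}`, the `L²` norm of the gradient. -/
def normV (v : V Ω) : ℝ := ‖gradient v‖

/-- The norm of `V'` dual to `‖·‖_V`. -/
def normV' (f : V' Ω) : ℝ≥0∞ := ⨆ (v : V Ω) (_ : normV v ≤ 1), ‖f v‖ₑ

/-- The form `a(u, v) = (∇u, ∇v)`. -/
def a (u v : V Ω) : ℝ := inner ℝ (gradient u) (gradient v)

/-- The trilinear form `b(u, v, w) = ∫_Ω ((u · ∇) v) · w`. -/
def b (u v w : V Ω) : ℝ :=
  ∫ x in Ω, ∑ i, ∑ j, field u x j * gradient v x (i, j) * field w x i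

/-- The best constant in the Poincaré inequality `‖v‖_H ≤ c ‖v‖_V` on `V`. -/
def poincareConst (Ω : Set (E d)) : ℝ :=
  sInf {c : ℝ | 0 ≤ c ∧ ∀ v : V Ω, normH v ≤ c * normV v}

/-- `g` is the distributional derivative on `(0, ∞)` of the `V`-valued function `u`, where
`V ⊂ H = H' ⊂ V'`. -/
def IsTimeDeriv (u : ℝ → V Ω) (g : ℝ → V' Ω) : Prop :=
  ∀ ψ : ℝ → ℝ, ContDiff ℝ ∞ ψ → HasCompactSupport ψ → tsupport ψ ⊆ Ioi 0 → ∀ v : V Ω,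
    ∫ t in Ioi (0 : ℝ), deriv ψ t * inner ℝ (field (u t)) (field v) =
      -∫ t in Ioi (0 : ℝ), ψ t * g t v

/-- `u` is a weak solution on `[0, ∞)` of the Navier-Stokes equations in `Ω` with viscosity
`ν(t)`, force `f` and initial value `u₀` (that is, on `[0, S]` for every `S > 0`):
`u ∈ L²(0, S; V) ∩ C_w([0, S]; H)`, `du/dt ∈ L¹_loc((0, S]; V')`, and for all `v ∈ V`
`⟨du/dt, v⟩ + ν a(u, v) + b(u, u, v) = ⟨f, v⟩` for almost every `t`, and `u(0) = u₀`.
Here `w` is the weakly continuous representative of `u`. -/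
structure IsWeakSolution (Ω : Set (E d)) (ν : ℝ → ℝ) (f : ℝ → V' Ω) (u₀ : H Ω)
    (u : ℝ → V Ω) : Prop where
  memLp : ∀ S : ℝ, MemLp u 2 (volume.restrict (Ioc 0 S))
  weakCont : ∃ w : ℝ → H Ω,
    (∀ᵐ t ∂volume.restrict (Ioi 0), (w t : L2 Ω (E d)) = field (u t)) ∧
    (∀ S : ℝ, ∃ M : ℝ, ∀ t ∈ Icc 0 S, ‖w t‖ ≤ M) ∧
    (∀ h : H Ω, ContinuousOn (fun t => (inner ℝ (w t) h : ℝ)) (Ici 0)) ∧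
    w 0 = u₀
  equation : ∃ g : ℝ → V' Ω, LocallyIntegrableOn g (Ioi 0) ∧ IsTimeDeriv u g ∧
    ∀ v : V Ω, ∀ᵐ t ∂volume.restrict (Ioi 0),
      g t v + ν t * a (u t) v + b (u t) (u t) v = f t v

/-- The (strong) energy inequality
`½ ‖u(t)‖_H² + ∫_s^t ν ‖u‖_V² ≤ ½ ‖u(s)‖_H² + ∫_s^t ⟨f, u⟩`
for almost all `0 < s < t`. -/
def EnergyInequality (ν : ℝ → ℝ) (f : ℝ → V' Ω) (u : ℝ → V Ω) : Prop :=
  ∀ᵐ s ∂volume.restrict (Ioi (0 : ℝ)), ∀ᵐ t ∂volume.restrict (Ioi s),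
    normH (u t) ^ 2 / 2 + ∫ τ in s..t, ν τ * normV (u τ) ^ 2 ≤
      normH (u s) ^ 2 / 2 + ∫ τ in s..t, f τ (u τ)

/-- `limsup_{t → ∞} ∫_0^t exp(-φ_s(t) / c²) ds` with `φ_s(t) = ∫_s^t ν(z) dz`. -/
def Kbar (ν : ℝ → ℝ) (c : ℝ) : ℝ :=
  limsup (fun t : ℝ => ∫ s in (0 : ℝ)..t, Real.exp (-(∫ z in s..t, ν z) / c ^ 2)) atTop

end NSE

end

noncomputable section

namespace NSE

/-! Write y = ‖u‖_H² and D = ‖u‖_V², and suppose that ‖f‖_{V'}² ≤ M from some time on. Young's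
inequality absorbs half of the dissipation in the energy inequality and leaves y(t) + ∫_s^t ν D ≤
y(s) + κ (t - s) with κ = M/νlow. Since D ≥ y/c² by Poincaré, y satisfies y' + (ν/c²) y ≤ κ in
integrated form. Gronwall then bounds y for large times by κ K̄ up to a small error, because `Kbar`
is built from exactly the kernel of Duhamel's formula. Fed back into the energy inequality on a
window of length T, this gives νlow ∫ D ≤ κ (K̄ + T) up to a small error. Dividing by νlow T and
using T ≥ c²/νlow produces the constant. Finally M tends to the limsup of ‖f‖_{V'}².

Two points need care. First, the energy inequality holds only for almost all s and then almost all
t, so y has no usable derivative and no distinguished initial time. `exp_mul_le_of_integral_ineq` is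
a Gronwall argument that compares a fixed final time with almost every earlier one, and
`ae_antitone_swap` puts the quantifiers in that order by Fubini.

Second, in dimension two the energy inequality has to be proved
(`energyInequality_of_isWeakSolution`). Ladyzhenskaya's inequality and the antisymmetry of b place
du/dt in L²(0,S;V'). The energy identity then follows from ‖u(t+h)‖² - ‖u(t)‖² = (u(t+h) - u(t),
u(t+h) + u(t)): the first factor is the integral of du/dt, and after division by h and integration
in t the limit h → 0 is taken by continuity of translations in L². -/

/-! ### Gronwall's inequality for relations between almost all times -/

theorem absolutelyContinuousOnInterval_exp_integral {α : ℝ → ℝ} {Λ s t : ℝ} (hst : s ≤ t)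
    (hα : IntervalIntegrable α volume s t) (hΛ : ∀ r ∈ Ioc s t, |α r| ≤ Λ) :
    AbsolutelyContinuousOnInterval (fun r => Real.exp (∫ z in s..r, α z)) s t := by
  have hint : ∀ x ∈ Icc s t, ∀ y ∈ Icc s t, IntervalIntegrable α volume x y := fun x hx y hy =>
    hα.mono_set (uIcc_subset_uIcc (by rwa [uIcc_of_le hst]) (by rwa [uIcc_of_le hst]))
  have hA : LipschitzOnWith Λ.toNNReal (fun r => ∫ z in s..r, α z) (Icc s t) := by
    refine LipschitzOnWith.of_dist_le_mul fun x hx y hy => ?_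
    have e : (∫ z in s..x, α z) - (∫ z in s..y, α z) = (∫ z in y..x, α z : ℝ) :=
      intervalIntegral.integral_interval_sub_left (hint _ ⟨le_rfl, hst⟩ _ hx)
        (hint _ ⟨le_rfl, hst⟩ _ hy)
    rw [Real.dist_eq, e, Real.dist_eq, ← Real.norm_eq_abs]
    refine intervalIntegral.norm_integral_le_of_norm_le_const fun z hz => ?_
    refine (hΛ z ?_).trans (Real.le_coe_toNNReal Λ)
    rcases le_total x y with h | h
    · rw [uIoc_of_ge h] at hz; exact ⟨hx.1.trans_lt hz.1, hz.2.trans hy.2⟩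
    · rw [uIoc_of_le h] at hz; exact ⟨hy.1.trans_lt hz.1, hz.2.trans hx.2⟩
  -- The exponential is only locally Lipschitz, so it is restricted to the compact range of the
  -- primitive.
  have hK : IsCompact ((fun r => ∫ z in s..r, α z) '' Icc s t) :=
    isCompact_Icc.image_of_continuousOn hA.continuousOn
  have hexp : ContDiff ℝ 1 Real.exp := Real.contDiff_exp
  obtain ⟨K, hKL⟩ := hexp.locallyLipschitz.locallyLipschitzOn
    |>.exists_lipschitzOnWith_of_compact hK
  have := hKL.comp hA (mapsTo_image _ _)
  rw [← uIcc_of_le hst] at this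
  exact this.absolutelyContinuousOnInterval

/-- Gronwall's inequality for a dissipative integral inequality that holds almost everywhere. -/
theorem exp_mul_le_of_integral_ineq {α y : ℝ → ℝ} {Λ κ s t : ℝ} (hst : s ≤ t)
    (hα : IntervalIntegrable α volume s t) (h0 : ∀ r ∈ Ioc s t, 0 ≤ α r)
    (hΛ : ∀ r ∈ Ioc s t, α r ≤ Λ) (hαy : IntervalIntegrable (fun r => α r * y r) volume s t)
    (hs : y t + ∫ z in s..t, (α z * y z - κ) ≤ y s)
    (hr : ∀ᵐ r, r ∈ Ioc s t → y t + ∫ z in r..t, (α z * y z - κ) ≤ y r) :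
    Real.exp (∫ z in s..t, α z) * y t ≤
      y s + κ * ∫ r in s..t, Real.exp (∫ z in s..r, α z) := by
  set k : ℝ → ℝ := fun z => α z * y z - κ with hk
  set E : ℝ → ℝ := fun r => Real.exp (∫ z in s..r, α z) with hE
  set Y : ℝ → ℝ := fun r => ∫ z in s..r, k z with hY
  have hki : IntervalIntegrable k volume s t := hαy.sub intervalIntegrable_const
  have hEac : AbsolutelyContinuousOnInterval E s t :=
    absolutelyContinuousOnInterval_exp_integral hst hα
      fun r hr => by rw [abs_of_nonneg (h0 r hr)]; exact hΛ r hr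
  have hYac : AbsolutelyContinuousOnInterval Y s t :=
    hki.absolutelyContinuousOnInterval_intervalIntegral left_mem_uIcc
  have hEd : ∀ᵐ r, r ∈ uIoc s t → deriv E r = E r * α r := by
    filter_upwards [hα.ae_hasDerivAt_integral] with r h hr
    exact (h (uIoc_subset_uIcc hr) s left_mem_uIcc).exp.deriv
  have hYd : ∀ᵐ r, r ∈ uIoc s t → deriv Y r = k r := by
    filter_upwards [hki.ae_hasDerivAt_integral] with r h hr
    exact (h (uIoc_subset_uIcc hr) s left_mem_uIcc).deriv
  have hEs : E s = 1 := by simp [hE]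
  have hYs : Y s = 0 := by simp [hY]
  have hEα : IntervalIntegrable (fun r => E r * α r) volume s t :=
    hα.continuousOn_mul hEac.continuousOn
  have I1 : ∫ r in s..t, E r * α r = E t - 1 := by
    rw [← hEs, ← hEac.integral_deriv_eq_sub]
    exact (intervalIntegral.integral_congr_ae hEd).symm
  have I2 : ∫ r in s..t, (E r * α r * Y r + E r * k r) = E t * Y t := by
    have := hEac.integral_deriv_mul_eq_sub hYac
    rw [hYs, mul_zero, sub_zero] at this
    rw [← this]
    refine intervalIntegral.integral_congr_ae ?_
    filter_upwards [hEd, hYd] with r h1 h2 h3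
    rw [h1 h3, h2 h3]
  have hEi : IntervalIntegrable E volume s t := hEac.continuousOn.intervalIntegrable
  -- The hypothesis at r says y t + Y t ≤ y r + Y r. Multiplied by E α ≥ 0 and integrated in r, it
  -- involves y only under integrals, so y is never differentiated; the right side is the integral
  -- of (E Y)', known from `I2`.
  have I3 : ∫ r in s..t, ((y t + Y t) * (E r * α r) - κ * E r) ≤
      ∫ r in s..t, (E r * α r * Y r + E r * k r) := by
    refine intervalIntegral.integral_mono_ae_restrict hst
      ((hEα.const_mul _).sub (hEi.const_mul _))
      ((hEα.mul_continuousOn hYac.continuousOn).add (hki.continuousOn_mul hEac.continuousOn)) ?_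
    rw [← restrict_Ioc_eq_restrict_Icc]
    refine (ae_restrict_iff' measurableSet_Ioc).2 ?_
    filter_upwards [hr] with r h hrm
    have e : (∫ z in r..t, k z) = Y t - Y r := by
      rw [hY]
      refine (intervalIntegral.integral_interval_sub_left hki
        (hki.mono_set (uIcc_subset_uIcc left_mem_uIcc ?_))).symm
      rw [uIcc_of_le hst]; exact Ioc_subset_Icc_self hrm
    have h1 := h hrm
    rw [e] at h1
    have h2 : 0 ≤ E r * α r := mul_nonneg (Real.exp_pos _).le (h0 r hrm)
    have h3 := mul_le_mul_of_nonneg_right (show y t + Y t ≤ y r + Y r by linarith) h2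
    simp only [hk]
    linarith
  rw [intervalIntegral.integral_sub (hEα.const_mul _) (hEi.const_mul _),
    intervalIntegral.integral_const_mul, intervalIntegral.integral_const_mul, I1, I2] at I3
  change E t * y t ≤ y s + κ * ∫ r in s..t, E r
  have : y t + Y t ≤ y s := hs
  linarith

/-- The quantifiers in an almost everywhere monotonicity statement can be exchanged. -/
theorem ae_antitone_swap {a : ℝ} {Z : ℝ → ℝ} (hZ : AEMeasurable Z (volume.restrict (Ioi a)))
    (h : ∀ᵐ s ∂volume.restrict (Ioi a), ∀ᵐ t ∂volume.restrict (Ioi s), Z t ≤ Z s) :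
    ∀ᵐ t ∂volume.restrict (Ioi a), ∀ᵐ s, s ∈ Ioo a t → Z t ≤ Z s := by
  set μ := (volume : Measure ℝ).restrict (Ioi a)
  have hlt : MeasurableSet {p : ℝ × ℝ | ¬ p.1 < p.2} :=
    (measurableSet_lt measurable_fst measurable_snd).compl
  -- Exchanging the quantifiers by Fubini needs a measurable subset of the plane, hence the
  -- measurable representative `hZ.mk Z`.
  have hQ : MeasurableSet {p : ℝ × ℝ | p.1 < p.2 → hZ.mk Z p.2 ≤ hZ.mk Z p.1} := by
    have : {p : ℝ × ℝ | p.1 < p.2 → hZ.mk Z p.2 ≤ hZ.mk Z p.1} =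
        {p : ℝ × ℝ | ¬ p.1 < p.2} ∪ {p : ℝ × ℝ | hZ.mk Z p.2 ≤ hZ.mk Z p.1} := by
      ext p; simp [imp_iff_not_or]
    rw [this]
    exact hlt.union (measurableSet_le (hZ.measurable_mk.comp measurable_snd)
      (hZ.measurable_mk.comp measurable_fst))
  have h1 : ∀ᵐ s ∂μ, ∀ᵐ t ∂μ, s < t → hZ.mk Z t ≤ hZ.mk Z s := by
    filter_upwards [h, hZ.ae_eq_mk] with s hs has
    have h2 := ae_restrict_of_ae (s := Ioi a) ((ae_restrict_iff' measurableSet_Ioi).1 hs)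
    filter_upwards [h2, hZ.ae_eq_mk] with t ht hat hst
    rw [← has, ← hat]
    exact ht hst
  have h3 := (Measure.ae_ae_comm hQ).1 h1
  filter_upwards [h3, hZ.ae_eq_mk] with t ht hat
  filter_upwards [(ae_restrict_iff' measurableSet_Ioi).1 ht,
    (ae_restrict_iff' measurableSet_Ioi).1 hZ.ae_eq_mk] with s hs has hst
  rw [has hst.1, hat]
  exact hs hst.1 hst.2

theorem intervalIntegrable_of_integrableOn_Ioc {F : Type*} [NormedAddCommGroup F] {g : ℝ → F}
    {a : ℝ} (h : ∀ S, IntegrableOn g (Ioc a S)) {s t : ℝ} (hs : a ≤ s) (ht : a ≤ t) :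
    IntervalIntegrable g volume s t := by
  rw [intervalIntegrable_iff]
  refine (h (max s t)).mono_set fun x hx => ⟨?_, hx.2⟩
  exact (le_min hs ht).trans_lt hx.1

theorem aemeasurable_Ioi_of_integrableOn_Ioc {g : ℝ → ℝ} {a : ℝ}
    (h : ∀ S, IntegrableOn g (Ioc a S)) : AEMeasurable g (volume.restrict (Ioi a)) := by
  have : Ioi a = ⋃ n : ℕ, Ioc a n := by
    ext x
    simp only [mem_Ioi, mem_iUnion, mem_Ioc]
    exact ⟨fun hx => (exists_nat_ge x).imp fun n hn => ⟨hx, hn⟩, fun ⟨n, hn⟩ => hn.1⟩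
  rw [this]
  exact AEMeasurable.iUnion fun n => (h n).aestronglyMeasurable.aemeasurable

/-- Exponential decay from a dissipative integral inequality between almost all times. -/
theorem ae_le_of_dissipative_ineq {α y : ℝ → ℝ} {a Λ κ : ℝ}
    (hα : ∀ S, IntegrableOn α (Ioc a S)) (h0 : ∀ r ∈ Ioi a, 0 ≤ α r)
    (hΛ : ∀ r ∈ Ioi a, α r ≤ Λ) (hy : ∀ S, IntegrableOn y (Ioc a S))
    (hαy : ∀ S, IntegrableOn (fun r => α r * y r) (Ioc a S))
    (h : ∀ᵐ s ∂volume.restrict (Ioi a), ∀ᵐ t ∂volume.restrict (Ioi s),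
      y t + ∫ z in s..t, (α z * y z - κ) ≤ y s) :
    ∀ᵐ s ∂volume.restrict (Ioi a), ∀ᵐ t ∂volume.restrict (Ioi s),
      y t ≤ Real.exp (-∫ z in s..t, α z) * y s +
        κ * ∫ r in s..t, Real.exp (-∫ z in r..t, α z) := by
  set k : ℝ → ℝ := fun z => α z * y z - κ with hk
  have hkS : ∀ S, IntegrableOn k (Ioc a S) := fun S => (hαy S).sub (integrableOn_const (by simp))
  have hki : ∀ {s t}, a ≤ s → a ≤ t → IntervalIntegrable k volume s t := fun hs ht =>
    intervalIntegrable_of_integrableOn_Ioc hkS hs ht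
  have hαi : ∀ {s t}, a ≤ s → a ≤ t → IntervalIntegrable α volume s t := fun hs ht =>
    intervalIntegrable_of_integrableOn_Ioc hα hs ht
  -- Adding the primitive of k turns the integral inequality into plain monotonicity, Z t ≤ Z s.
  set Z : ℝ → ℝ := fun t => y t + ∫ z in a..t, k z with hZ
  have key : ∀ {s t}, a ≤ s → a ≤ t → (y t + ∫ z in s..t, k z ≤ y s ↔ Z t ≤ Z s) := by
    intro s t hs ht
    have : (∫ z in a..s, k z) + (∫ z in s..t, k z) = ∫ z in a..t, k z :=
      intervalIntegral.integral_add_adjacent_intervals (hki le_rfl hs) (hki hs ht)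
    simp only [hZ]
    constructor <;> intro h <;> linarith
  have hZm : AEMeasurable Z (volume.restrict (Ioi a)) := by
    refine (aemeasurable_Ioi_of_integrableOn_Ioc hy).add ?_
    have hc : ContinuousOn (fun t => ∫ z in a..t, k z) (Ici a) := by
      intro t ht
      have h1 := intervalIntegral.continuousOn_primitive_interval' (a := a)
        (hki (le_refl a) (show a ≤ t + 1 by linarith [mem_Ici.1 ht])) left_mem_uIcc
      rw [uIcc_of_le (by linarith [mem_Ici.1 ht])] at h1
      refine (h1 t ⟨ht, by linarith⟩).mono_of_mem_nhdsWithin ?_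
      rw [← Ici_inter_Iic]
      exact inter_mem_nhdsWithin _ (Iic_mem_nhds (by linarith))
    exact (hc.mono Ioi_subset_Ici_self).aemeasurable measurableSet_Ioi
  have hZs : ∀ᵐ s ∂volume.restrict (Ioi a), ∀ᵐ t ∂volume.restrict (Ioi s), Z t ≤ Z s := by
    filter_upwards [h, ae_restrict_mem measurableSet_Ioi] with s hs has
    filter_upwards [hs, ae_restrict_mem measurableSet_Ioi] with t ht hst
    exact (key (le_of_lt has) (le_of_lt (lt_trans has hst))).1 ht
  -- The hypothesis fixes the earlier time, whereas the Gronwall argument fixes the final time and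
  -- varies the earlier one.
  have hsw := ae_antitone_swap hZm hZs
  filter_upwards [h, ae_restrict_mem measurableSet_Ioi] with s hs has
  have hsw' : ∀ᵐ t ∂volume.restrict (Ioi s), ∀ᵐ r, r ∈ Ioo a t → Z t ≤ Z r :=
    ae_restrict_of_ae_restrict_of_subset (Ioi_subset_Ioi (le_of_lt has)) hsw
  filter_upwards [hs, hsw', ae_restrict_mem measurableSet_Ioi] with t ht hz hst
  have has' : a ≤ s := le_of_lt has
  have hst' : s ≤ t := le_of_lt hst
  have hat : a ≤ t := has'.trans hst'
  have hsub : ∀ r ∈ Ioc s t, r ∈ Ioi a := fun r hr => has'.trans_lt hr.1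
  have main := exp_mul_le_of_integral_ineq (κ := κ) (Λ := Λ) hst' (hαi has' hat)
    (fun r hr => h0 r (hsub r hr)) (fun r hr => hΛ r (hsub r hr))
    (intervalIntegrable_of_integrableOn_Ioc hαy has' hat) ht (by
      have hne : ∀ᵐ r : ℝ, r ≠ t := by simp [ae_iff, measure_singleton]
      filter_upwards [hz, hne] with r hr hrt hr'
      have har : a < r := hsub r hr'
      exact (key har.le hat).2 (hr ⟨har, lt_of_le_of_ne hr'.2 hrt⟩))
  have e1 : ∫ r in s..t, Real.exp (-∫ z in r..t, α z) =
      Real.exp (-∫ z in s..t, α z) * ∫ r in s..t, Real.exp (∫ z in s..r, α z) := by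
    rw [← intervalIntegral.integral_const_mul]
    refine intervalIntegral.integral_congr fun r hr => ?_
    rw [uIcc_of_le hst'] at hr
    have : (∫ z in s..r, α z) + (∫ z in r..t, α z) = ∫ z in s..t, α z :=
      intervalIntegral.integral_add_adjacent_intervals (hαi has' (has'.trans hr.1))
        (hαi (has'.trans hr.1) hat)
    simp only [← Real.exp_add]
    congr 1; linarith
  have h2 := mul_le_mul_of_nonneg_left main (Real.exp_pos (-∫ z in s..t, α z)).le
  rw [← mul_assoc, ← Real.exp_add, neg_add_cancel, Real.exp_zero, one_mul] at h2
  rw [e1]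
  linarith

/-- A set of full measure in `(a, ∞)` meets every interval `(x, y)` with `a ≤ x < y`. -/
theorem exists_mem_Ioo_of_ae_Ioi {P : ℝ → Prop} {a x y : ℝ}
    (h : ∀ᵐ t ∂volume.restrict (Ioi a), P t) (hax : a ≤ x) (hxy : x < y) :
    ∃ t ∈ Ioo x y, P t := by
  have h1 : ∀ᵐ t ∂volume.restrict (Ioo x y), P t ∧ t ∈ Ioo x y :=
    (ae_restrict_of_ae_restrict_of_subset (fun t ht => hax.trans_lt ht.1) h).and
      (ae_restrict_mem measurableSet_Ioo)
  have : NeBot (ae ((volume : Measure ℝ).restrict (Ioo x y))) := by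
    rw [ae_neBot, Ne, Measure.restrict_eq_zero]
    simp [hxy]
  obtain ⟨t, ht⟩ := h1.exists
  exact ⟨t, ht.2, ht.1⟩

/-! ### The Duhamel kernel and its limsup -/

section Kbar

variable {ν : ℝ → ℝ} {νlow c : ℝ}

theorem integral_exp_le (hν : ∀ S, IntegrableOn ν (Ioc 0 S)) (hlow : ∀ t ∈ Ioi (0 : ℝ), νlow ≤ ν t)
    {s t : ℝ} (hs : 0 ≤ s) (hst : s ≤ t) :
    Real.exp (-(∫ z in s..t, ν z) / c ^ 2) ≤ Real.exp (-(νlow / c ^ 2 * (t - s))) := by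
  have h1 : ∫ z in s..t, νlow ≤ ∫ z in s..t, ν z := by
    refine intervalIntegral.integral_mono_on_of_le_Ioo hst intervalIntegrable_const
      (intervalIntegrable_of_integrableOn_Ioc hν hs (hs.trans hst)) fun z hz => ?_
    exact hlow z (hs.trans_lt hz.1)
  rw [intervalIntegral.integral_const, smul_eq_mul] at h1
  refine Real.exp_le_exp.2 ?_
  rw [neg_div, neg_le_neg_iff, div_mul_eq_mul_div]
  gcongr
  linarith

theorem intervalIntegrable_exp_integral (hν : ∀ S, IntegrableOn ν (Ioc 0 S))
    {t : ℝ} (ht : 0 ≤ t) : IntervalIntegrable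
      (fun s => Real.exp (-(∫ z in s..t, ν z) / c ^ 2)) volume 0 t := by
  refine ContinuousOn.intervalIntegrable ?_
  have h1 : ContinuousOn (fun s => ∫ z in t..s, ν z) (uIcc 0 t) :=
    intervalIntegral.continuousOn_primitive_interval'
      (intervalIntegrable_of_integrableOn_Ioc hν le_rfl ht) right_mem_uIcc
  have h2 : (fun s => Real.exp (-(∫ z in s..t, ν z) / c ^ 2)) =
      fun s => Real.exp ((∫ z in t..s, ν z) / c ^ 2) := by
    funext s; rw [← intervalIntegral.integral_symm]
  rw [h2]
  exact (h1.div_const _).rexp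

/-- Comparison with the kernel of constant viscosity νlow, whose integral is explicit. Boundedness
is what makes the real-valued `limsup` in `Kbar` meaningful. -/
theorem Kbar_integral_bounds (hν : ∀ S, IntegrableOn ν (Ioc 0 S))
    (hlow : ∀ t ∈ Ioi (0 : ℝ), νlow ≤ ν t) (hpos : 0 < νlow) (hc : 0 < c) {t : ℝ} (ht : 0 ≤ t) :
    (∫ s in (0 : ℝ)..t, Real.exp (-(∫ z in s..t, ν z) / c ^ 2)) ∈ Icc 0 (c ^ 2 / νlow) := by
  have hk : 0 < νlow / c ^ 2 := by positivity
  refine ⟨intervalIntegral.integral_nonneg ht fun s _ => (Real.exp_pos _).le, ?_⟩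
  have hd : ∀ x ∈ uIcc 0 t, HasDerivAt (fun s => (νlow / c ^ 2)⁻¹ *
      Real.exp (-(νlow / c ^ 2 * (t - s)))) (Real.exp (-(νlow / c ^ 2 * (t - x)))) x := by
    intro x _
    have h : HasDerivAt (fun s => -(νlow / c ^ 2 * (t - s))) (νlow / c ^ 2) x := by
      have := (((hasDerivAt_id x).const_sub t).const_mul (νlow / c ^ 2)).fun_neg
      simpa using this
    have h2 := h.exp.const_mul (νlow / c ^ 2)⁻¹
    rwa [mul_comm (Real.exp _), inv_mul_cancel_left₀ hk.ne'] at h2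
  have hcont : Continuous fun s : ℝ => Real.exp (-(νlow / c ^ 2 * (t - s))) := by fun_prop
  calc _ ≤ ∫ s in (0 : ℝ)..t, Real.exp (-(νlow / c ^ 2 * (t - s))) := by
        refine intervalIntegral.integral_mono_on ht (intervalIntegrable_exp_integral hν ht)
          (hcont.intervalIntegrable _ _) fun s hs => integral_exp_le hν hlow hs.1 hs.2
    _ = (νlow / c ^ 2)⁻¹ - (νlow / c ^ 2)⁻¹ * Real.exp (-(νlow / c ^ 2 * (t - 0))) := by
        rw [intervalIntegral.integral_eq_sub_of_hasDerivAt hd (hcont.intervalIntegrable _ _)]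
        simp
    _ ≤ c ^ 2 / νlow := by
        rw [inv_div]
        have : 0 ≤ c ^ 2 / νlow * Real.exp (-(νlow / c ^ 2 * (t - 0))) := by positivity
        linarith

theorem Kbar_nonneg (hν : ∀ S, IntegrableOn ν (Ioc 0 S))
    (hlow : ∀ t ∈ Ioi (0 : ℝ), νlow ≤ ν t) (hpos : 0 < νlow) (hc : 0 < c) : 0 ≤ Kbar ν c := by
  refine le_limsup_of_frequently_le (Eventually.frequently ?_) ?_
  · filter_upwards [eventually_ge_atTop 0] with t ht
    exact (Kbar_integral_bounds hν hlow hpos hc ht).1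
  · refine isBoundedUnder_of_eventually_le (a := c ^ 2 / νlow) ?_
    filter_upwards [eventually_ge_atTop 0] with t ht
    exact (Kbar_integral_bounds hν hlow hpos hc ht).2

theorem eventually_lt_Kbar_add (hν : ∀ S, IntegrableOn ν (Ioc 0 S))
    (hlow : ∀ t ∈ Ioi (0 : ℝ), νlow ≤ ν t) (hpos : 0 < νlow) (hc : 0 < c) {ε : ℝ} (hε : 0 < ε) :
    ∀ᶠ t in atTop, (∫ s in (0 : ℝ)..t, Real.exp (-(∫ z in s..t, ν z) / c ^ 2)) <
      Kbar ν c + ε := by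
  refine eventually_lt_of_limsup_lt (lt_add_of_pos_right _ hε) ?_
  refine isBoundedUnder_of_eventually_le (a := c ^ 2 / νlow) ?_
  filter_upwards [eventually_ge_atTop 0] with t ht
  exact (Kbar_integral_bounds hν hlow hpos hc ht).2

end Kbar

/-! ### From the energy inequality to the averaged dissipation -/

/-- Absorption of the force by the dissipation in an energy inequality. -/
theorem dissipative_ineq_of_energy_ineq {ν D y p : ℝ → ℝ} {νlow M a : ℝ} (hpos : 0 < νlow)
    (hlow : ∀ t ∈ Ioi a, νlow ≤ ν t) (hM : 0 ≤ M) (hD0 : ∀ t, 0 ≤ D t)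
    (hνD : ∀ S, IntegrableOn (fun t => ν t * D t) (Ioc a S))
    (hp : ∀ S, IntegrableOn p (Ioc a S)) (hpM : ∀ t ∈ Ioi a, p t ^ 2 ≤ M * D t)
    (h : ∀ᵐ s ∂volume.restrict (Ioi a), ∀ᵐ t ∂volume.restrict (Ioi s),
      y t / 2 + ∫ τ in s..t, ν τ * D τ ≤ y s / 2 + ∫ τ in s..t, p τ) :
    ∀ᵐ s ∂volume.restrict (Ioi a), ∀ᵐ t ∂volume.restrict (Ioi s),
      y t + ∫ τ in s..t, ν τ * D τ ≤ y s + M / νlow * (t - s) := by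
  filter_upwards [h, ae_restrict_mem measurableSet_Ioi] with s hs has
  filter_upwards [hs, ae_restrict_mem measurableSet_Ioi] with t ht hst
  have has' : a ≤ s := le_of_lt has
  have hst' : s ≤ t := le_of_lt hst
  have i1 := intervalIntegrable_of_integrableOn_Ioc hνD has' (has'.trans hst')
  have i2 := intervalIntegrable_of_integrableOn_Ioc hp has' (has'.trans hst')
  -- Young's inequality through squares: p² ≤ M D ≤ (M/νlow)(ν D) ≤ ((M/νlow + ν D)/2)².
  have h1 : ∫ τ in s..t, p τ ≤ ∫ τ in s..t, (M / νlow / 2 + ν τ * D τ / 2) := by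
    refine intervalIntegral.integral_mono_on_of_le_Ioo hst' i2
      (intervalIntegrable_const.add (i1.div_const 2)) fun τ hτ => ?_
    have hτa : τ ∈ Ioi a := has'.trans_lt hτ.1
    have h2 : 0 ≤ M / νlow / 2 + ν τ * D τ / 2 := by
      have := mul_nonneg (hpos.le.trans (hlow τ hτa)) (hD0 τ)
      positivity
    refine (abs_le_of_sq_le_sq' ?_ h2).2
    have h3 : M * D τ ≤ M / νlow * (ν τ * D τ) := by
      have h4 : νlow * D τ ≤ ν τ * D τ := mul_le_mul_of_nonneg_right (hlow τ hτa) (hD0 τ)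
      have h5 := mul_le_mul_of_nonneg_left h4 (show 0 ≤ M / νlow by positivity)
      rwa [← mul_assoc, div_mul_cancel₀ _ hpos.ne'] at h5
    nlinarith [hpM τ hτa, sq_nonneg (M / νlow / 2 - ν τ * D τ / 2)]
  rw [intervalIntegral.integral_add intervalIntegrable_const (i1.div_const 2),
    intervalIntegral.integral_const, intervalIntegral.integral_div, smul_eq_mul] at h1
  linarith

/-- The asymptotic bound of the kinetic energy and of the averaged dissipation which follows
from the energy inequality. -/
theorem eventually_lintegral_le_of_energy_ineq {ν D y p : ℝ → ℝ} {νlow νup c M t₀ T : ℝ}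
    (hν : ∀ S, IntegrableOn ν (Ioc 0 S)) (hpos : 0 < νlow)
    (hlow : ∀ t ∈ Ioi (0 : ℝ), νlow ≤ ν t) (hup : ∀ t ∈ Ioi (0 : ℝ), ν t ≤ νup)
    (hc : 0 < c) (hM : 0 ≤ M) (hD0 : ∀ t, 0 ≤ D t) (hy0 : ∀ t, 0 ≤ y t)
    (hyD : ∀ t, y t ≤ c ^ 2 * D t) (hD : ∀ S, IntegrableOn D (Ioc 0 S))
    (hy : ∀ S, IntegrableOn y (Ioc 0 S)) (hp : ∀ S, IntegrableOn p (Ioc 0 S))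
    (ht₀ : 0 ≤ t₀) (hpM : ∀ t ∈ Ioi t₀, p t ^ 2 ≤ M * D t) (hT : 0 < T)
    (h : ∀ᵐ s ∂volume.restrict (Ioi (0 : ℝ)), ∀ᵐ t ∂volume.restrict (Ioi s),
      y t / 2 + ∫ τ in s..t, ν τ * D τ ≤ y s / 2 + ∫ τ in s..t, p τ)
    {ε : ℝ} (hε : 0 < ε) :
    ∀ᶠ t in atTop, ∫⁻ τ in Ioc t (t + T), ENNReal.ofReal (D τ) ≤
      ENNReal.ofReal (M / νlow ^ 2 * (Kbar ν c + T) + ε) := by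
  have bdd : ∀ (g : ℝ → ℝ), (∀ S, IntegrableOn g (Ioc 0 S)) →
      ∀ S, IntegrableOn (fun t => ν t * g t) (Ioc 0 S) := by
    intro g hg S
    refine Integrable.bdd_mul (c := νup) (hg S) (hν S).aestronglyMeasurable ?_
    filter_upwards [ae_restrict_mem measurableSet_Ioc] with t ht
    rw [Real.norm_eq_abs, abs_of_nonneg (hpos.le.trans (hlow t ht.1))]
    exact hup t ht.1
  have mono : ∀ {g : ℝ → ℝ}, (∀ S, IntegrableOn g (Ioc 0 S)) → ∀ S, IntegrableOn g (Ioc t₀ S) :=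
    fun hg S => (hg S).mono_set (Ioc_subset_Ioc_left ht₀)
  have sub : Ioi t₀ ⊆ Ioi 0 := Ioi_subset_Ioi ht₀
  have hE := dissipative_ineq_of_energy_ineq hpos (fun t ht => hlow t (sub ht)) hM hD0
    (mono (bdd D hD)) (mono hp) hpM (ae_restrict_of_ae_restrict_of_subset sub h)
  set κ := M / νlow with hκ
  have hκ0 : 0 ≤ κ := by positivity
  -- By Poincaré, ν D ≥ (ν/c²) y, so y is damped at rate ν/c².
  have hdec := ae_le_of_dissipative_ineq (α := fun t => ν t / c ^ 2) (y := y) (a := t₀)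
    (Λ := νup / c ^ 2) (κ := κ) (fun S => (mono hν S).div_const _)
    (fun t ht => div_nonneg (hpos.le.trans (hlow t (sub ht))) (by positivity))
    (fun t ht => div_le_div_of_nonneg_right (hup t (sub ht)) (by positivity)) (mono hy)
    (fun S => ((mono (bdd y hy) S).div_const (c ^ 2)).congr
      (Eventually.of_forall fun t => by simp only; ring)) (by
      filter_upwards [hE, ae_restrict_mem measurableSet_Ioi] with s hs has
      filter_upwards [hs, ae_restrict_mem measurableSet_Ioi] with t ht hst
      have has' : t₀ ≤ s := le_of_lt has
      have hst' : s ≤ t := le_of_lt hst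
      have i1 := intervalIntegrable_of_integrableOn_Ioc (mono (bdd D hD)) has' (has'.trans hst')
      have i2 : IntervalIntegrable (fun z => ν z / c ^ 2 * y z) volume s t :=
        ((intervalIntegrable_of_integrableOn_Ioc (mono (bdd y hy)) has'
          (has'.trans hst')).div_const (c ^ 2)).congr
          (fun t _ => by ring)
      rw [intervalIntegral.integral_sub i2 intervalIntegrable_const,
        intervalIntegral.integral_const, smul_eq_mul]
      have h1 : ∫ z in s..t, ν z / c ^ 2 * y z ≤ ∫ z in s..t, ν z * D z := by
        refine intervalIntegral.integral_mono_on_of_le_Ioo hst' i2 i1 fun z hz => ?_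
        rw [div_mul_eq_mul_div, mul_div_assoc]
        refine mul_le_mul_of_nonneg_left ?_
          (hpos.le.trans (hlow z (sub (has'.trans_lt hz.1))))
        rw [div_le_iff₀ (by positivity)]
        linarith [hyD z]
      linarith)
  obtain ⟨s₀, ⟨hs₀, -⟩, hs₀d⟩ := exists_mem_Ioo_of_ae_Ioi hdec le_rfl (lt_add_one t₀)
  have hs₀' : 0 ≤ s₀ := ht₀.trans hs₀.le
  -- The errors below add up to η (1 + κ), from the bound on y, plus 2 κ η, from enlarging the
  -- window; the 2 in place of 1 is slack.
  obtain ⟨η, hη, hηε⟩ : ∃ η : ℝ, 0 < η ∧ η * (2 + κ + 2 * κ) ≤ νlow * ε := by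
    refine ⟨νlow * ε / (2 + κ + 2 * κ), by positivity, le_of_eq ?_⟩
    field_simp
  have hlim : Tendsto (fun t => Real.exp (-(νlow / c ^ 2 * (t - s₀))) * y s₀) atTop (𝓝 0) := by
    rw [← zero_mul (y s₀)]
    refine Tendsto.mul_const _ (Real.tendsto_exp_neg_atTop_nhds_zero.comp ?_)
    refine Tendsto.const_mul_atTop (by positivity) ?_
    simpa [sub_eq_add_neg] using tendsto_atTop_add_const_right atTop (-s₀) tendsto_id
  obtain ⟨t₁, ht₁⟩ := eventually_atTop.1 ((hlim.eventually (gt_mem_nhds hη)).and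
    ((eventually_lt_Kbar_add hν hlow hpos hc hη).and (eventually_gt_atTop s₀)))
  have hybd : ∀ᵐ t ∂volume.restrict (Ioi (max t₁ s₀)),
      y t ≤ κ * Kbar ν c + η * (1 + κ) := by
    filter_upwards [ae_restrict_of_ae_restrict_of_subset (Ioi_subset_Ioi (le_max_right t₁ s₀)) hs₀d,
      ae_restrict_mem measurableSet_Ioi] with t ht htm
    have htt : t₁ ≤ t := (le_max_left _ _).trans (le_of_lt htm)
    obtain ⟨a1, a2, a3⟩ := ht₁ t htt
    have e : ∀ r : ℝ, -∫ z in r..t, ν z / c ^ 2 = -(∫ z in r..t, ν z) / c ^ 2 := fun r => by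
      rw [intervalIntegral.integral_div, neg_div]
    simp only [e] at ht
    have b1 := mul_le_mul_of_nonneg_right (integral_exp_le (c := c) hν hlow hs₀' a3.le) (hy0 s₀)
    have hi := intervalIntegrable_exp_integral (c := c) hν (hs₀'.trans a3.le)
    have m1 : s₀ ∈ uIcc 0 t := by rw [uIcc_of_le (hs₀'.trans a3.le)]; exact ⟨hs₀', a3.le⟩
    -- The kernel is positive, so starting its integral at 0 instead of s₀ is harmless, and only
    -- then does it match `Kbar`.
    have b2 : ∫ s in s₀..t, Real.exp (-(∫ z in s..t, ν z) / c ^ 2) ≤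
        ∫ s in (0 : ℝ)..t, Real.exp (-(∫ z in s..t, ν z) / c ^ 2) := by
      rw [← intervalIntegral.integral_add_adjacent_intervals
        (hi.mono_set (uIcc_subset_uIcc left_mem_uIcc m1))
        (hi.mono_set (uIcc_subset_uIcc m1 right_mem_uIcc))]
      have := intervalIntegral.integral_nonneg (μ := volume) hs₀' fun s (_ : s ∈ Icc 0 s₀) =>
        (Real.exp_pos (-(∫ z in s..t, ν z) / c ^ 2)).le
      linarith
    have b3 := mul_le_mul_of_nonneg_left (b2.trans a2.le) hκ0
    linarith
  have hmax : t₀ ≤ max t₁ s₀ := hs₀.le.trans (le_max_right _ _)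
  filter_upwards [eventually_ge_atTop (max t₁ s₀ + η)] with t ht
  -- The bounds are available only at almost all times, so the window is enlarged by less than η on
  -- each side to end at admissible times.
  obtain ⟨s, hs, hsy, hsE⟩ := exists_mem_Ioo_of_ae_Ioi
    (hybd.and (ae_restrict_of_ae_restrict_of_subset (Ioi_subset_Ioi hmax) hE))
    (show max t₁ s₀ ≤ t - η by linarith) (show t - η < t by linarith)
  obtain ⟨s', hs', hsE'⟩ := exists_mem_Ioo_of_ae_Ioi hsE
    (show s ≤ t + T by linarith [hs.2]) (show t + T < t + T + η by linarith)
  have hs0 : 0 ≤ s := by linarith [hs.1]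
  have hss' : s ≤ s' := by linarith [hs.2, hs'.1]
  have hDi := intervalIntegrable_of_integrableOn_Ioc hD hs0 (hs0.trans hss')
  have hνDi := intervalIntegrable_of_integrableOn_Ioc (bdd D hD) hs0 (hs0.trans hss')
  have c1 : νlow * ∫ τ in s..s', D τ ≤ ∫ τ in s..s', ν τ * D τ := by
    rw [← intervalIntegral.integral_const_mul]
    exact intervalIntegral.integral_mono_on_of_le_Ioo hss' (hDi.const_mul _) hνDi fun z hz =>
      mul_le_mul_of_nonneg_right (hlow z (hs0.trans_lt hz.1)) (hD0 z)
  have c2 : νlow * ∫ τ in s..s', D τ ≤ κ * (Kbar ν c + T) + νlow * ε := by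
    have c3 : κ * (s' - s) ≤ κ * (T + 2 * η) :=
      mul_le_mul_of_nonneg_left (by linarith [hs.1, hs'.2]) hκ0
    have c4 := hy0 s'
    nlinarith
  have c5 : ∫ τ in s..s', D τ ≤ M / νlow ^ 2 * (Kbar ν c + T) + ε := by
    have e : νlow * (M / νlow ^ 2 * (Kbar ν c + T) + ε) = κ * (Kbar ν c + T) + νlow * ε := by
      rw [hκ]; field_simp
    rw [← e] at c2
    exact le_of_mul_le_mul_left c2 hpos
  calc ∫⁻ τ in Ioc t (t + T), ENNReal.ofReal (D τ)
      ≤ ∫⁻ τ in Ioc s s', ENNReal.ofReal (D τ) :=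
        lintegral_mono_set (Ioc_subset_Ioc hs.2.le hs'.1.le)
    _ = ENNReal.ofReal (∫ τ in s..s', D τ) := by
        rw [intervalIntegral.integral_of_le hss', ofReal_integral_eq_lintegral_ofReal hDi.1
          (ae_of_all _ hD0)]
    _ ≤ _ := ENNReal.ofReal_le_ofReal c5

/-! ### The space V: density, Poincaré's inequality, the dual norm -/

section

variable {d : ℕ} {Ω : Set (E d)}

theorem field_add (v w : V Ω) : field (v + w) = field v + field w := rfl

theorem field_smul (c : ℝ) (v : V Ω) : field (c • v) = c • field v := rfl

theorem gradient_add (v w : V Ω) : gradient (v + w) = gradient v + gradient w := rfl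

theorem gradient_smul (c : ℝ) (v : V Ω) : gradient (c • v) = c • gradient v := rfl

theorem norm_sq_eq (v : V Ω) : ‖v‖ ^ 2 = normH v ^ 2 + normV v ^ 2 :=
  WithLp.prod_norm_sq_eq_of_L2 v.1

theorem normH_nonneg (v : V Ω) : 0 ≤ normH v := norm_nonneg _

theorem normV_nonneg (v : V Ω) : 0 ≤ normV v := norm_nonneg _

theorem normH_le_norm (v : V Ω) : normH v ≤ ‖v‖ :=
  (sq_le_sq₀ (norm_nonneg _) (norm_nonneg _)).1
    (by rw [norm_sq_eq]; change normH v ^ 2 ≤ _; nlinarith [sq_nonneg (normV v)])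

theorem normV_le_norm (v : V Ω) : normV v ≤ ‖v‖ :=
  (sq_le_sq₀ (norm_nonneg _) (norm_nonneg _)).1
    (by rw [norm_sq_eq]; change normV v ^ 2 ≤ _; nlinarith [sq_nonneg (normH v)])

/-- The inclusion `V → L²(Ω)` as a continuous linear map. -/
def fieldL (Ω : Set (E d)) : V Ω →L[ℝ] L2 Ω (E d) :=
  LinearMap.mkContinuous { toFun := field, map_add' := field_add, map_smul' := field_smul } 1
    fun v => by rw [one_mul]; exact normH_le_norm v

/-- The weak gradient `V → L²(Ω)` as a continuous linear map. -/
def gradientL (Ω : Set (E d)) : V Ω →L[ℝ] L2 Ω (G d) :=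
  LinearMap.mkContinuous
    { toFun := gradient, map_add' := gradient_add, map_smul' := gradient_smul } 1
    fun v => by rw [one_mul]; exact normV_le_norm v

theorem continuous_field : Continuous (field : V Ω → L2 Ω (E d)) := (fieldL Ω).continuous

theorem continuous_gradient : Continuous (gradient : V Ω → L2 Ω (G d)) := (gradientL Ω).continuous

/-- A closed property that holds for the divergence free test fields holds on all of `V`. -/
theorem V_induction {P : V Ω → Prop} (hP : IsClosed {v | P v})
    (h : ∀ v : V Ω, ∀ φ ∈ testFields Ω, field v =ᵐ[volume.restrict Ω] φ →
      gradient v =ᵐ[volume.restrict Ω] grad φ → P v) (v : V Ω) : P v := by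
  have hd : v ∈ closure {v : V Ω | v.1 ∈ testH1 Ω} := by
    refine (closure_subtype (x := v) (s := {v : VSub Ω | v.1 ∈ testH1 Ω})).2 ?_
    have e : (Subtype.val '' {v : VSub Ω | v.1 ∈ testH1 Ω}) = (testH1 Ω : Set (Pairs Ω)) := by
      ext x
      simp only [mem_image, mem_ofPred_eq, SetLike.mem_coe]
      exact ⟨fun ⟨y, hy, hyx⟩ => hyx ▸ hy,
        fun hx => ⟨⟨x, (testH1 Ω).le_topologicalClosure hx⟩, hx, rfl⟩⟩
    rw [e, ← Submodule.topologicalClosure_coe]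
    exact v.2
  refine closure_minimal ?_ hP hd
  rintro w ⟨φ, hφ, h1, h2⟩
  exact h w φ hφ h1 h2

/-- Allows the weak continuity in H to be tested against elements of V. -/
theorem field_mem_H (v : V Ω) : field v ∈ H Ω :=
  V_induction (P := fun v => field v ∈ H Ω)
    ((testL2 Ω).isClosed_topologicalClosure.preimage continuous_field)
    (fun _ φ hφ h _ => (testL2 Ω).le_topologicalClosure ⟨φ, hφ, h⟩) v

/-- Cauchy–Schwarz in each row. Sobolev inequalities control `fderiv` in operator norm, whereas
`grad` carries the Frobenius norm. -/
theorem norm_clm_le_matrix (A : E d →L[ℝ] E d) :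
    ‖A‖ ≤ ‖(WithLp.toLp 2 fun p : Fin d × Fin d =>
      (A (EuclideanSpace.single p.2 1)) p.1 : G d)‖ := by
  refine A.opNorm_le_bound (norm_nonneg _) fun v => ?_
  refine (sq_le_sq₀ (norm_nonneg _) (by positivity)).1 ?_
  rw [mul_pow, EuclideanSpace.norm_sq_eq, EuclideanSpace.norm_sq_eq, EuclideanSpace.norm_sq_eq,
    Fintype.sum_prod_type, Finset.sum_mul]
  refine Finset.sum_le_sum fun i _ => ?_
  have hv : v = ∑ j, v j • EuclideanSpace.single j (1 : ℝ) := by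
    ext k; simp [Finset.sum_apply, Pi.single_apply]
  have e : (A v) i = ∑ j, (A (EuclideanSpace.single j 1)) i * v j := by
    conv_lhs => rw [hv]
    rw [map_sum]
    simp [Finset.sum_apply, mul_comm]
  rw [Real.norm_eq_abs, sq_abs, e]
  refine (Finset.sum_mul_sq_le_sq_mul_sq _ _ _).trans_eq ?_
  simp

theorem norm_fderiv_le_norm_grad (φ : E d → E d) (x : E d) : ‖fderiv ℝ φ x‖ ≤ ‖grad φ x‖ :=
  norm_clm_le_matrix _

theorem support_fderiv_subset_of_mem_testFields {φ : E d → E d} (hφ : φ ∈ testFields Ω) :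
    Function.support (fderiv ℝ φ) ⊆ Ω :=
  (support_fderiv_subset ℝ).trans hφ.2.2.1

theorem enorm_field_eq {v : V Ω} {φ : E d → E d} (h : field v =ᵐ[volume.restrict Ω] φ) :
    ENNReal.ofReal (normH v) = eLpNorm φ 2 (volume.restrict Ω) := by
  rw [normH, Lp.norm_def, ENNReal.ofReal_toReal (Lp.eLpNorm_ne_top _), eLpNorm_congr_ae h]

theorem enorm_gradient_eq {v : V Ω} {φ : E d → E d}
    (h : gradient v =ᵐ[volume.restrict Ω] grad φ) :
    ENNReal.ofReal (normV v) = eLpNorm (grad φ) 2 (volume.restrict Ω) := by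
  rw [normV, Lp.norm_def, ENNReal.ofReal_toReal (Lp.eLpNorm_ne_top _), eLpNorm_congr_ae h]

/-- The Poincaré inequality on `V`. -/
theorem exists_poincare (hd : d = 2 ∨ d = 3) (hΩb : Bornology.IsBounded Ω) :
    ∃ C : ℝ, 0 ≤ C ∧ ∀ v : V Ω, normH v ≤ C * normV v := by
  -- The Sobolev inequality into L² needs 1 ≤ p < d and 1/p - 1/d ≤ 1/2. The exponent p = 3/2 serves
  -- both d = 2 and d = 3; Hölder on the bounded set Ω then raises it to 2, at the price of a power
  -- of the volume.
  set K : ℝ≥0∞ := eLpNormLESNormFDerivOfLeConst (E d) (volume : Measure (E d)) Ω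
    ((3 / 2 : NNReal)) 2 * volume.restrict Ω univ ^ (1 / (3 / 2 : ℝ≥0∞).toReal - 1 / (2 : ℝ≥0∞).toReal)
    with hK
  have hKt : K ≠ ⊤ := by
    refine ENNReal.mul_ne_top ENNReal.coe_ne_top (ENNReal.rpow_ne_top_of_nonneg ?_ ?_)
    · norm_num
    · simpa using hΩb.measure_lt_top.ne
  refine ⟨K.toReal, ENNReal.toReal_nonneg, fun v => ?_⟩
  refine V_induction (P := fun v => normH v ≤ K.toReal * normV v)
    (isClosed_le continuous_field.norm (continuous_const.mul continuous_gradient.norm)) ?_ v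
  intro v φ hφ h1 h2
  rw [← ENNReal.ofReal_le_ofReal_iff (mul_nonneg ENNReal.toReal_nonneg (normV_nonneg v)),
    ENNReal.ofReal_mul ENNReal.toReal_nonneg, ENNReal.ofReal_toReal hKt, enorm_field_eq h1,
    enorm_gradient_eq h2]
  have hs : Function.support φ ⊆ Ω := (subset_tsupport φ).trans hφ.2.2.1
  have hC1 : ContDiff ℝ 1 φ := hφ.1.of_le (by exact_mod_cast le_top)
  have gns := eLpNorm_le_eLpNorm_fderiv_of_le (volume : Measure (E d)) (p := 3 / 2) (q := 2)
    hC1 hs (by rw [← NNReal.coe_le_coe]; push_cast; norm_num)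
    (by
      rw [finrank_euclideanSpace_fin, ← NNReal.coe_lt_coe]
      push_cast
      rcases hd with rfl | rfl <;> norm_num)
    (by
      rw [finrank_euclideanSpace_fin]
      push_cast
      rcases hd with rfl | rfl <;> norm_num) hΩb
  calc eLpNorm φ 2 (volume.restrict Ω) ≤ eLpNorm φ 2 volume :=
        eLpNorm_mono_measure _ Measure.restrict_le_self
    _ ≤ _ := gns
    _ = eLpNormLESNormFDerivOfLeConst (E d) (volume : Measure (E d)) Ω (3 / 2) 2 *
        eLpNorm (fderiv ℝ φ) (3 / 2) (volume.restrict Ω) := by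
        have e := eLpNorm_restrict_eq_of_support_subset (μ := volume) (p := (3 / 2 : ℝ≥0∞))
          (ε := E d →L[ℝ] E d) (f := fderiv ℝ φ) (support_fderiv_subset_of_mem_testFields hφ)
        rw [e]
        congr 2
        rw [ENNReal.coe_div two_ne_zero]
        rfl
    _ ≤ eLpNormLESNormFDerivOfLeConst (E d) (volume : Measure (E d)) Ω (3 / 2) 2 *
        (eLpNorm (fderiv ℝ φ) 2 (volume.restrict Ω) * volume.restrict Ω univ ^
          (1 / (3 / 2 : ℝ≥0∞).toReal - 1 / (2 : ℝ≥0∞).toReal)) := by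
        gcongr
        refine eLpNorm_le_eLpNorm_mul_rpow_measure_univ ?_ ?_
        · refine ENNReal.div_le_of_le_mul ?_
          norm_num
        · exact (hC1.continuous_fderiv one_ne_zero).aestronglyMeasurable
    _ = K * eLpNorm (fderiv ℝ φ) 2 (volume.restrict Ω) := by
        rw [hK]; ring
    _ ≤ K * eLpNorm (grad φ) 2 (volume.restrict Ω) := by
        gcongr
        exact eLpNorm_mono fun x => norm_fderiv_le_norm_grad φ x

/-- When ∇v ≠ 0, the quotient `normH v / normV v` is a lower bound of the set of admissible
constants, which is nonempty by `exists_poincare`. When ∇v = 0, that lemma gives the claim directly.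
-/
theorem poincare (hd : d = 2 ∨ d = 3) (hΩb : Bornology.IsBounded Ω) {c : ℝ}
    (hc : poincareConst Ω ≤ c) (v : V Ω) : normH v ≤ c * normV v := by
  obtain ⟨C, hC⟩ := exists_poincare hd hΩb
  rcases (normV_nonneg v).eq_or_lt with h | h
  · have := hC.2 v
    rw [← h, mul_zero] at this ⊢
    exact this
  · rw [← div_le_iff₀ h]
    refine le_trans ?_ hc
    refine le_csInf ⟨C, hC⟩ fun x hx => ?_
    rw [div_le_iff₀ h]
    exact hx.2 v

/-- Scale v to `normV` one. This is impossible if ∇v = 0, but then v = 0 by Poincaré. -/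
theorem sq_apply_le_of_normV'_sq_le (hd : d = 2 ∨ d = 3)
    (hΩb : Bornology.IsBounded Ω) {g : V' Ω} {M : ℝ} (hM : 0 ≤ M)
    (h : normV' g ^ 2 ≤ ENNReal.ofReal M) (v : V Ω) : g v ^ 2 ≤ M * normV v ^ 2 := by
  rcases (normV_nonneg v).eq_or_lt with hv | hv
  · obtain ⟨C, hC⟩ := exists_poincare hd hΩb
    have h1 := hC.2 v
    rw [← hv, mul_zero] at h1
    have h2 := norm_sq_eq v
    rw [← hv, le_antisymm h1 (normH_nonneg v)] at h2
    have h3 : v = 0 := by simpa using h2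
    rw [h3, map_zero, zero_pow two_ne_zero]
    positivity
  · set w : V Ω := (normV v)⁻¹ • v
    have hw : normV w ≤ 1 := by
      rw [normV, gradient_smul, norm_smul, norm_inv, Real.norm_of_nonneg hv.le]
      exact (inv_mul_cancel₀ hv.ne').le
    have h1 : ‖g w‖ₑ ≤ normV' g := le_iSup₂ (f := fun (v : V Ω) (_ : normV v ≤ 1) => ‖g v‖ₑ) w hw
    have h2 : ‖g w‖ₑ ^ 2 ≤ ENNReal.ofReal M := le_trans (by gcongr) h
    rw [← ofReal_norm, ← ENNReal.ofReal_pow (norm_nonneg _),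
      ENNReal.ofReal_le_ofReal_iff hM, Real.norm_eq_abs, sq_abs] at h2
    have h3 : g w = (normV v)⁻¹ * g v := by simp [w]
    rw [h3, mul_pow, inv_pow, inv_mul_le_iff₀ (by positivity)] at h2
    linarith

end

/-! ### Ladyzhenskaya's inequality, and the convection term on test fields -/

section

variable {d : ℕ} {Ω : Set (E d)}

/-- ∇|φ|² = 2 φ·∇φ and Cauchy–Schwarz. Ladyzhenskaya's inequality is the L¹ Sobolev inequality
applied to |φ|². -/
theorem eLpNorm_fderiv_norm_sq_le {φ : E d → E d} (hφ : ContDiff ℝ 1 φ) :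
    eLpNorm (fderiv ℝ fun x => ‖φ x‖ ^ 2) 1 volume ≤
      2 * eLpNorm φ 2 volume * eLpNorm (fderiv ℝ φ) 2 volume := by
  have hD : ∀ x, ‖fderiv ℝ (fun x => ‖φ x‖ ^ 2) x‖ ≤ ‖(2 * ‖φ x‖) * ‖fderiv ℝ φ x‖‖ := by
    intro x
    have h : fderiv ℝ (fun x => ‖φ x‖ ^ 2) x = 2 • (innerSL ℝ (φ x)).comp (fderiv ℝ φ x) :=
      ((hφ.differentiable one_ne_zero x).hasFDerivAt.norm_sq).fderiv
    rw [h, ← Nat.cast_smul_eq_nsmul ℝ, norm_smul, Nat.cast_ofNat, Real.norm_ofNat, norm_mul, norm_mul,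
      norm_norm, norm_norm, Real.norm_ofNat, mul_assoc]
    gcongr
    refine (ContinuousLinearMap.opNorm_comp_le _ _).trans ?_
    rw [innerSL_apply_norm]
  have h2 := eLpNorm_le_eLpNorm_mul_eLpNorm'_of_norm (μ := volume) (p := 2) (q := 2) (r := 1)
    hφ.continuous.norm.aestronglyMeasurable
    (hφ.continuous_fderiv one_ne_zero).norm.aestronglyMeasurable
    (fun a b : ℝ => (2 * a) * b) 2 (ae_of_all _ fun x => by
      rw [norm_mul, norm_mul, Real.norm_ofNat]; rfl)
  rw [eLpNorm_norm, eLpNorm_norm] at h2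
  exact (eLpNorm_mono hD).trans h2

theorem eLpNorm_norm_sq_two (φ : E d → E d) :
    eLpNorm (fun x => ‖φ x‖ ^ 2) 2 volume = eLpNorm φ 4 volume ^ 2 := by
  have h := eLpNorm_norm_rpow (p := 2) (q := 2) (μ := volume) φ two_pos
  simp only [Real.rpow_two, ENNReal.rpow_two] at h
  rw [h, ENNReal.ofReal_ofNat]
  congr 2
  norm_num

/-- The endpoint Sobolev exponent d/(d-1) equals 2 in the plane. -/
theorem eLpNorm_le_fderiv_plane {q : E 2 → ℝ} (hq : ContDiff ℝ 1 q) (hqc : HasCompactSupport q) :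
    eLpNorm q 2 volume ≤ eLpNormLESNormFDerivOneConst (volume : Measure (E 2)) 2 *
      eLpNorm (fderiv ℝ q) 1 volume := by
  have hconj : NNReal.HolderConjugate ((Module.finrank ℝ (E 2) : ℕ) : NNReal) 2 := by
    rw [finrank_euclideanSpace_fin, NNReal.holderConjugate_iff]
    refine ⟨by norm_num, ?_⟩
    rw [← NNReal.coe_inj]; push_cast; norm_num
  have gns := eLpNorm_le_eLpNorm_fderiv_one (volume : Measure (E 2)) hq hqc hconj
  rwa [NNReal.coe_ofNat] at gns

/-- Ladyzhenskaya's inequality for compactly supported fields in the plane. -/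
theorem eLpNorm_four_sq_le {φ : E 2 → E 2} (hφ : ContDiff ℝ 1 φ) (hc : HasCompactSupport φ) :
    eLpNorm φ 4 volume ^ 2 ≤ eLpNormLESNormFDerivOneConst (volume : Measure (E 2)) 2 *
      (2 * (eLpNorm φ 2 volume * eLpNorm (fderiv ℝ φ) 2 volume)) := by
  rw [← eLpNorm_norm_sq_two, ← mul_assoc 2]
  refine (eLpNorm_le_fderiv_plane (hφ.norm_sq ℝ)
    (hc.comp_left (g := fun v => ‖v‖ ^ 2) (by simp))).trans ?_
  gcongr
  exact eLpNorm_fderiv_norm_sq_le hφ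

/-- Fatou along an almost everywhere convergent subsequence. It carries L^p bounds from test fields
to V without prior knowledge that the L^p norm is finite or continuous there. -/
theorem isClosed_eLpNorm_field_le (p : ℝ≥0∞) {R : V Ω → ℝ≥0∞} (hR : Continuous R) :
    IsClosed {v : V Ω | eLpNorm (field v) p (volume.restrict Ω) ≤ R v} := by
  refine IsSeqClosed.isClosed fun u v hu huv => ?_
  have h1 : Tendsto (fun n => field (u n)) atTop (𝓝 (field v)) :=
    (continuous_field.tendsto v).comp huv
  obtain ⟨ns, hns, hae⟩ := (tendstoInMeasure_of_tendsto_Lp h1).exists_seq_tendsto_ae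
  have h2 := Lp.eLpNorm_lim_le_liminf_eLpNorm (p := p)
    (fun n => Lp.aestronglyMeasurable (field (u (ns n)))) (field v) hae
  refine h2.trans ?_
  have h3 : Tendsto (fun n => R (u (ns n))) atTop (𝓝 (R v)) :=
    (hR.tendsto v).comp (huv.comp hns.tendsto_atTop)
  rw [← h3.liminf_eq]
  exact liminf_le_liminf (Eventually.of_forall fun n => hu (ns n))

/-- The `L⁴` norm of the field of an element of `V`. -/
def norm4 (v : V Ω) : ℝ := (eLpNorm (field v) 4 (volume.restrict Ω)).toReal

/-- Ladyzhenskaya's inequality on `V`, in dimension two. -/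
theorem exists_ladyzhenskaya (Ω : Set (E 2)) : ∃ K : ℝ, 0 ≤ K ∧ ∀ v : V Ω,
    MemLp (field v) 4 (volume.restrict Ω) ∧ norm4 v ^ 2 ≤ K * (normH v * normV v) := by
  set K : ℝ := eLpNormLESNormFDerivOneConst (volume : Measure (E 2)) 2 * 2 with hK
  have hK0 : 0 ≤ K := by positivity
  refine ⟨K, hK0, fun v => ?_⟩
  -- The bound is proved in `ℝ≥0∞` first, so that density applies; membership in L⁴ is read off from
  -- it.
  have key : eLpNorm (field v) 4 (volume.restrict Ω) ≤
      ENNReal.ofReal (Real.sqrt (K * (normH v * normV v))) := by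
    refine V_induction (P := fun v => eLpNorm (field v) 4 (volume.restrict Ω) ≤
      ENNReal.ofReal (Real.sqrt (K * (normH v * normV v))))
      (isClosed_eLpNorm_field_le 4 (ENNReal.continuous_ofReal.comp (Real.continuous_sqrt.comp
        (continuous_const.mul (continuous_field.norm.mul continuous_gradient.norm))))) ?_ v
    intro v φ hφ h1 h2
    have hC1 : ContDiff ℝ 1 φ := hφ.1.of_le (by exact_mod_cast le_top)
    have hs : Function.support φ ⊆ Ω := (subset_tsupport φ).trans hφ.2.2.1
    have lad := eLpNorm_four_sq_le hC1 hφ.2.1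
    have e1 := eLpNorm_restrict_eq_of_support_subset (μ := volume) (p := (2 : ℝ≥0∞))
      (ε := E 2 →L[ℝ] E 2) (f := fderiv ℝ φ) (support_fderiv_subset_of_mem_testFields hφ)
    have e2 := eLpNorm_restrict_eq_of_support_subset (μ := volume) (p := (2 : ℝ≥0∞))
      (f := φ) hs
    have e3 := eLpNorm_restrict_eq_of_support_subset (μ := volume) (p := (4 : ℝ≥0∞))
      (f := φ) hs
    rw [← e1, ← e2, ← e3] at lad
    have h4 : eLpNorm (fderiv ℝ φ) 2 (volume.restrict Ω) ≤ ENNReal.ofReal (normV v) := by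
      rw [enorm_gradient_eq h2]
      exact eLpNorm_mono fun x => norm_fderiv_le_norm_grad φ x
    rw [eLpNorm_congr_ae h1]
    rw [← ENNReal.pow_le_pow_left_iff two_ne_zero, ← ENNReal.ofReal_pow (Real.sqrt_nonneg _),
      Real.sq_sqrt (mul_nonneg hK0 (mul_nonneg (normH_nonneg v) (normV_nonneg v))),
      ENNReal.ofReal_mul hK0, ENNReal.ofReal_mul (normH_nonneg v), enorm_field_eq h1, hK,
      ENNReal.ofReal_mul (by positivity), ENNReal.ofReal_coe_nnreal, ENNReal.ofReal_ofNat,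
      mul_assoc]
    refine lad.trans ?_
    gcongr
  refine ⟨⟨Lp.aestronglyMeasurable _, key.trans_lt ENNReal.ofReal_lt_top⟩, ?_⟩
  have h1 : norm4 v ≤ Real.sqrt (K * (normH v * normV v)) :=
    ENNReal.toReal_le_of_le_ofReal (Real.sqrt_nonneg _) key
  calc norm4 v ^ 2 ≤ Real.sqrt (K * (normH v * normV v)) ^ 2 :=
        pow_le_pow_left₀ ENNReal.toReal_nonneg h1 2
    _ = _ := Real.sq_sqrt (mul_nonneg hK0 (mul_nonneg (normH_nonneg v) (normV_nonneg v)))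

section TestFields

variable {φ ψ χ : E d → E d}

theorem continuous_grad (hφ : ContDiff ℝ ∞ φ) : Continuous (grad φ) := by
  have h : Continuous (fderiv ℝ φ) := hφ.continuous_fderiv (by simp)
  refine (PiLp.continuous_toLp 2 _).comp (continuous_pi fun p => ?_)
  exact (EuclideanSpace.proj p.1).continuous.comp (h.clm_apply continuous_const)

/-- The integral over the whole space of the convection term against the derivative of a
scalar vanishes. -/
theorem integral_transport_eq_zero (hφ : φ ∈ testFields Ω) {q : E d → ℝ} (hq : ContDiff ℝ ∞ q) :
    ∫ x, ∑ j, φ x j * fderiv ℝ q x (EuclideanSpace.single j 1) = 0 := by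
  have hφj : ∀ j, ContDiff ℝ ∞ (fun x => φ x j) := fun j =>
    (EuclideanSpace.proj (𝕜 := ℝ) j).contDiff.comp hφ.1
  have hcj : ∀ j, HasCompactSupport (fun x => φ x j) := fun j =>
    hφ.2.1.comp_left (g := fun v : E d => v j) rfl
  have hd : ∀ j x, fderiv ℝ (fun x => φ x j) x (EuclideanSpace.single j 1) = grad φ x (j, j) := by
    intro j x
    have h := ((EuclideanSpace.proj (𝕜 := ℝ) j).hasFDerivAt (x := φ x)).comp x
      (hφ.1.differentiable (by simp) x).hasFDerivAt
    exact congrArg (fun A => A (EuclideanSpace.single j 1)) h.fderiv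
  have hcd : ∀ j, Continuous fun x => fderiv ℝ (fun x => φ x j) x (EuclideanSpace.single j 1) :=
    fun j => ((hφj j).continuous_fderiv (by simp)).clm_apply continuous_const
  have hqd : ∀ j : Fin d, Continuous fun x => fderiv ℝ q x (EuclideanSpace.single j 1) :=
    fun j => (hq.continuous_fderiv (by simp)).clm_apply continuous_const
  have i1 : ∀ j, Integrable (fun x => φ x j * fderiv ℝ q x (EuclideanSpace.single j 1)) := fun j =>
    ((hφj j).continuous.mul (hqd j)).integrable_of_hasCompactSupport (hcj j).mul_right
  have i2 : ∀ j, Integrable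
      (fun x => fderiv ℝ (fun x => φ x j) x (EuclideanSpace.single j 1) * q x) := fun j =>
    ((hcd j).mul hq.continuous).integrable_of_hasCompactSupport
      ((hcj j).fderiv_apply ℝ _).mul_right
  have i3 : ∀ j, Integrable (fun x => φ x j * q x) := fun j =>
    ((hφj j).continuous.mul hq.continuous).integrable_of_hasCompactSupport (hcj j).mul_right
  rw [integral_finsetSum _ fun j _ => i1 j]
  -- Integration by parts in each component: the compact support of φ suffices, and the terms add up
  -- to -∫ q div φ.
  have h : ∀ j, ∫ x, φ x j * fderiv ℝ q x (EuclideanSpace.single j 1) =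
      -∫ x, fderiv ℝ (fun x => φ x j) x (EuclideanSpace.single j 1) * q x := fun j =>
    integral_mul_fderiv_eq_neg_fderiv_mul_of_integrable (i2 j) (i1 j) (i3 j)
      (fun x _ => (hφj j).differentiable (by simp) x) fun x _ => hq.differentiable (by simp) x
  simp_rw [h]
  rw [Finset.sum_neg_distrib, ← integral_finsetSum _ fun j _ => i2 j]
  simp_rw [← Finset.sum_mul, hd]
  have h0 : ∀ x, ∑ j, grad φ x (j, j) = 0 := hφ.2.2.2
  simp [h0]

/-- The product rule, ((φ·∇)ψ)·χ + ((φ·∇)χ)·ψ = φ·∇(ψ·χ). -/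
theorem sum_convection_add (hψ : ContDiff ℝ ∞ ψ) (hχ : ContDiff ℝ ∞ χ) (x : E d) :
    (∑ i, ∑ j, φ x j * grad ψ x (i, j) * χ x i) + ∑ i, ∑ j, φ x j * grad χ x (i, j) * ψ x i =
      ∑ j, φ x j * fderiv ℝ (fun x => inner ℝ (ψ x) (χ x)) x (EuclideanSpace.single j 1) := by
  rw [Finset.sum_comm, Finset.sum_comm (f := fun i j => φ x j * grad χ x (i, j) * ψ x i),
    ← Finset.sum_add_distrib]
  refine Finset.sum_congr rfl fun j _ => ?_
  rw [fderiv_inner_apply ℝ (hψ.differentiable (by simp) x) (hχ.differentiable (by simp) x),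
    PiLp.inner_apply, PiLp.inner_apply, ← Finset.sum_add_distrib, ← Finset.sum_add_distrib,
    Finset.mul_sum]
  refine Finset.sum_congr rfl fun i _ => ?_
  simp [grad]
  ring

/-- The sum is the transport of q = ψ·χ by the divergence free φ. Since φ vanishes off Ω, the
integral extends to the whole space. -/
theorem integral_convection_test (hφ : φ ∈ testFields Ω) (hψ : ψ ∈ testFields Ω)
    (hχ : χ ∈ testFields Ω) :
    (∫ x in Ω, ∑ i, ∑ j, φ x j * grad ψ x (i, j) * χ x i) +
      ∫ x in Ω, ∑ i, ∑ j, φ x j * grad χ x (i, j) * ψ x i = 0 := by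
  have cc : ∀ {f : E d → E d}, ContDiff ℝ ∞ f → ∀ i, Continuous fun x => f x i := fun hf i =>
    (EuclideanSpace.proj (𝕜 := ℝ) i).continuous.comp hf.continuous
  have cg : ∀ {f : E d → E d}, ContDiff ℝ ∞ f → ∀ p, Continuous fun x => grad f x p := fun hf p =>
    (EuclideanSpace.proj (𝕜 := ℝ) p).continuous.comp (continuous_grad hf)
  have hi : ∀ {f g : E d → E d}, ContDiff ℝ ∞ f → ContDiff ℝ ∞ g →
      Integrable (fun x => ∑ i, ∑ j, φ x j * grad f x (i, j) * g x i) := by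
    intro f g hf hg
    refine integrable_finsetSum _ fun i _ => integrable_finsetSum _ fun j _ => ?_
    exact (((cc hφ.1 j).mul (cg hf _)).mul (cc hg i)).integrable_of_hasCompactSupport
      ((hφ.2.1.comp_left (g := fun v : E d => v j) rfl).mul_right).mul_right
  rw [← integral_add (hi hψ.1 hχ.1).integrableOn (hi hχ.1 hψ.1).integrableOn]
  simp_rw [sum_convection_add hψ.1 hχ.1]
  rw [setIntegral_eq_integral_of_forall_compl_eq_zero]
  · exact integral_transport_eq_zero hφ (hψ.1.inner ℝ hχ.1)
  · intro x hx
    have : φ x = 0 := by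
      by_contra h
      exact hx (hφ.2.2.1 (subset_tsupport φ h))
    simp [this]

end TestFields

end

/-! ### The trilinear form on V -/

section

variable {d : ℕ} {Ω : Set (E d)}

instance holderTriple_four_four_two : ENNReal.HolderTriple 4 4 2 where
  inv_add_inv_eq_inv := by
    rw [← two_mul, show (4 : ℝ≥0∞) = 2 * 2 by norm_num,
      ENNReal.mul_inv (Or.inl two_ne_zero) (Or.inl ENNReal.ofNat_ne_top), ← mul_assoc,
      ENNReal.mul_inv_cancel two_ne_zero ENNReal.ofNat_ne_top, one_mul]

/-- Each of the d² terms is at most the product of the norms; the crude factor is harmless, since no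
constant of b enters the final bound. -/
theorem abs_convection_le (x y : E d) (A : G d) :
    |∑ i, ∑ j, x j * A (i, j) * y i| ≤ (d * d : ℝ) * (‖x‖ * ‖y‖ * ‖A‖) := by
  have h : ∀ i j, |x j * A (i, j) * y i| ≤ ‖x‖ * ‖y‖ * ‖A‖ := by
    intro i j
    rw [abs_mul, abs_mul, mul_right_comm]
    gcongr
    · exact PiLp.norm_apply_le x j
    · exact PiLp.norm_apply_le y i
    · exact PiLp.norm_apply_le A (i, j)
  calc _ ≤ ∑ i, |∑ j, x j * A (i, j) * y i| := Finset.abs_sum_le_sum_abs _ _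
    _ ≤ ∑ i : Fin d, ∑ j : Fin d, |x j * A (i, j) * y i| :=
        Finset.sum_le_sum fun i _ => Finset.abs_sum_le_sum_abs _ _
    _ ≤ ∑ _i : Fin d, ∑ _j : Fin d, ‖x‖ * ‖y‖ * ‖A‖ :=
        Finset.sum_le_sum fun i _ => Finset.sum_le_sum fun j _ => h i j
    _ = _ := by simp; ring

/-- The integrand of the trilinear form. -/
def convection (u v w : V Ω) (x : E d) : ℝ :=
  ∑ i, ∑ j, field u x j * gradient v x (i, j) * field w x i

theorem aestronglyMeasurable_convection (u v w : V Ω) :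
    AEStronglyMeasurable (convection u v w) (volume.restrict Ω) := by
  have hf : ∀ (v : V Ω) (i : Fin d), AEStronglyMeasurable (fun x => field v x i)
      (volume.restrict Ω) := fun v i =>
    (EuclideanSpace.proj (𝕜 := ℝ) i).continuous.comp_aestronglyMeasurable
      (Lp.aestronglyMeasurable (field v))
  have hg : ∀ p : Fin d × Fin d, AEStronglyMeasurable (fun x => gradient v x p)
      (volume.restrict Ω) := fun p =>
    (EuclideanSpace.proj (𝕜 := ℝ) p).continuous.comp_aestronglyMeasurable
      (Lp.aestronglyMeasurable (gradient v))
  exact Finset.aestronglyMeasurable_fun_sum _ fun i _ =>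
    Finset.aestronglyMeasurable_fun_sum _ fun j _ => ((hf u j).mul (hg (i, j))).mul (hf w i)

/-- Hölder with exponents 4, 4, 2: the two fields are multiplied into L², then paired with the
gradient. -/
theorem eLpNorm_convection_le (u v w : V Ω) :
    eLpNorm (convection u v w) 1 (volume.restrict Ω) ≤
      ENNReal.ofReal (d * d) * (eLpNorm (field u) 4 (volume.restrict Ω) *
        eLpNorm (field w) 4 (volume.restrict Ω) *
        eLpNorm (gradient v) 2 (volume.restrict Ω)) := by
  have h1 : eLpNorm (fun x => ‖field u x‖ * ‖field w x‖) 2 (volume.restrict Ω) ≤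
      eLpNorm (field u) 4 (volume.restrict Ω) * eLpNorm (field w) 4 (volume.restrict Ω) := by
    have h := eLpNorm_le_eLpNorm_mul_eLpNorm'_of_norm (p := 4) (q := 4) (r := 2)
      (Lp.aestronglyMeasurable (field u)).norm (Lp.aestronglyMeasurable (field w)).norm
      (fun a b : ℝ => a * b) 1 (ae_of_all _ fun x => by rw [norm_mul]; simp)
    simpa only [eLpNorm_norm, ENNReal.coe_one, one_mul] using h
  have h2 := eLpNorm_le_eLpNorm_mul_eLpNorm'_of_norm (p := 2) (q := 2) (r := 1)
    ((Lp.aestronglyMeasurable (field u)).norm.mul (Lp.aestronglyMeasurable (field w)).norm)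
    (Lp.aestronglyMeasurable (gradient v)).norm
    (fun a b : ℝ => a * b) 1 (ae_of_all _ fun x => by rw [norm_mul]; simp)
  rw [eLpNorm_norm, ENNReal.coe_one, one_mul] at h2
  refine (eLpNorm_le_mul_eLpNorm_of_ae_le_mul (ae_of_all _ fun x => ?_) 1).trans
    (mul_le_mul_right (h2.trans (mul_le_mul_left h1 _)) _)
  refine (abs_convection_le _ _ _).trans_eq ?_
  simp

variable {u v w : V Ω}

theorem integrable_convection (hu : MemLp (field u) 4 (volume.restrict Ω))
    (hw : MemLp (field w) 4 (volume.restrict Ω)) :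
    Integrable (convection u v w) (volume.restrict Ω) := by
  rw [← memLp_one_iff_integrable]
  refine ⟨aestronglyMeasurable_convection u v w, (eLpNorm_convection_le u v w).trans_lt ?_⟩
  exact ENNReal.mul_lt_top ENNReal.ofReal_lt_top
    (ENNReal.mul_lt_top (ENNReal.mul_lt_top hu.2 hw.2) (Lp.eLpNorm_lt_top _))

theorem abs_b_le (hu : MemLp (field u) 4 (volume.restrict Ω))
    (hw : MemLp (field w) 4 (volume.restrict Ω)) :
    |b u v w| ≤ (d * d : ℝ) * (norm4 u * norm4 w * normV v) := by
  have h1 := eLpNorm_convection_le u v w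
  have h2 : |b u v w| ≤ (eLpNorm (convection u v w) 1 (volume.restrict Ω)).toReal := by
    rw [eLpNorm_one_eq_lintegral_enorm, ← Real.norm_eq_abs]
    exact (norm_integral_le_lintegral_norm (convection u v w)).trans_eq
      (by simp only [ofReal_norm])
  refine h2.trans ((ENNReal.toReal_mono ?_ h1).trans_eq ?_)
  · exact (ENNReal.mul_lt_top ENNReal.ofReal_lt_top
      (ENNReal.mul_lt_top (ENNReal.mul_lt_top hu.2 hw.2) (Lp.eLpNorm_lt_top _))).ne
  · rw [ENNReal.toReal_mul, ENNReal.toReal_mul, ENNReal.toReal_mul,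
      ENNReal.toReal_ofReal (by positivity)]
    rfl

theorem b_add_left (u u' v w : V Ω)
    (h : ∀ v : V Ω, MemLp (field v) 4 (volume.restrict Ω)) :
    b (u + u') v w = b u v w + b u' v w := by
  change ∫ x in Ω, convection (u + u') v w x =
    (∫ x in Ω, convection u v w x) + ∫ x in Ω, convection u' v w x
  rw [← integral_add (integrable_convection (h u) (h w)) (integrable_convection (h u') (h w))]
  refine integral_congr_ae ?_
  filter_upwards [Lp.coeFn_add (field u) (field u')] with x hx
  simp only [convection, field_add, hx, Pi.add_apply, PiLp.add_apply, ← Finset.sum_add_distrib]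
  exact Finset.sum_congr rfl fun i _ => Finset.sum_congr rfl fun j _ => by ring

theorem b_add_mid (u v v' w : V Ω)
    (h : ∀ v : V Ω, MemLp (field v) 4 (volume.restrict Ω)) :
    b u (v + v') w = b u v w + b u v' w := by
  change ∫ x in Ω, convection u (v + v') w x =
    (∫ x in Ω, convection u v w x) + ∫ x in Ω, convection u v' w x
  rw [← integral_add (integrable_convection (h u) (h w)) (integrable_convection (h u) (h w))]
  refine integral_congr_ae ?_
  filter_upwards [Lp.coeFn_add (gradient v) (gradient v')] with x hx
  simp only [convection, gradient_add, hx, Pi.add_apply, PiLp.add_apply, ← Finset.sum_add_distrib]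
  exact Finset.sum_congr rfl fun i _ => Finset.sum_congr rfl fun j _ => by ring

theorem b_add_right (u v w w' : V Ω)
    (h : ∀ v : V Ω, MemLp (field v) 4 (volume.restrict Ω)) :
    b u v (w + w') = b u v w + b u v w' := by
  change ∫ x in Ω, convection u v (w + w') x =
    (∫ x in Ω, convection u v w x) + ∫ x in Ω, convection u v w' x
  rw [← integral_add (integrable_convection (h u) (h w)) (integrable_convection (h u) (h w'))]
  refine integral_congr_ae ?_
  filter_upwards [Lp.coeFn_add (field w) (field w')] with x hx
  simp only [convection, field_add, hx, Pi.add_apply, PiLp.add_apply, ← Finset.sum_add_distrib]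
  exact Finset.sum_congr rfl fun i _ => Finset.sum_congr rfl fun j _ => by ring

/-- A bounded additive real functional is continuous. -/
theorem continuous_of_additive_bound {X : Type*} [NormedAddCommGroup X] {F : X → ℝ} {C : ℝ}
    (hadd : ∀ x y, F (x + y) = F x + F y) (hb : ∀ x, |F x| ≤ C * ‖x‖) : Continuous F :=
  AddMonoidHomClass.continuous_of_bound (AddMonoidHom.mk' F hadd) C hb

section Plane

variable {Ω : Set (E 2)}

theorem memLp_field_four (v : V Ω) : MemLp (field v) 4 (volume.restrict Ω) :=
  ((exists_ladyzhenskaya Ω).choose_spec.2 v).1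

theorem exists_norm4_le (Ω : Set (E 2)) : ∃ K : ℝ, 0 ≤ K ∧ ∀ v : V Ω, norm4 v ≤ K * ‖v‖ := by
  obtain ⟨K, hK0, hK⟩ := exists_ladyzhenskaya Ω
  refine ⟨Real.sqrt K, Real.sqrt_nonneg _, fun v => ?_⟩
  refine (sq_le_sq₀ ENNReal.toReal_nonneg (by positivity)).1 ?_
  rw [mul_pow, Real.sq_sqrt hK0]
  refine (hK v).2.trans (mul_le_mul_of_nonneg_left ?_ hK0)
  rw [sq]
  exact mul_le_mul (normH_le_norm v) (normV_le_norm v) (normV_nonneg v) (norm_nonneg v)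

theorem norm4_nonneg (v : V Ω) : 0 ≤ norm4 v := ENNReal.toReal_nonneg

/-- Gives continuity of b in each argument, as the density arguments require. -/
theorem exists_abs_b_le (Ω : Set (E 2)) : ∃ K : ℝ, 0 ≤ K ∧ ∀ u v w : V Ω,
    |b u v w| ≤ K * (‖u‖ * ‖v‖ * ‖w‖) := by
  obtain ⟨K, hK0, hK⟩ := exists_norm4_le Ω
  refine ⟨4 * (K * K), by positivity, fun u v w => ?_⟩
  refine (abs_b_le (memLp_field_four u) (memLp_field_four w)).trans ?_
  have h1 : norm4 u * norm4 w * normV v ≤ (K * ‖u‖) * (K * ‖w‖) * ‖v‖ := by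
    have := norm4_nonneg u
    have := norm4_nonneg w
    have := normV_nonneg v
    gcongr
    exacts [hK u, hK w, normV_le_norm v]
  push_cast
  nlinarith

theorem continuous_b_left (v w : V Ω) : Continuous fun u : V Ω => b u v w := by
  obtain ⟨K, hK0, hK⟩ := exists_abs_b_le Ω
  exact continuous_of_additive_bound (C := K * (‖v‖ * ‖w‖))
    (fun u u' => b_add_left u u' v w memLp_field_four) fun u => (hK u v w).trans_eq (by ring)

theorem continuous_b_mid (u w : V Ω) : Continuous fun v : V Ω => b u v w := by
  obtain ⟨K, hK0, hK⟩ := exists_abs_b_le Ω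
  exact continuous_of_additive_bound (C := K * (‖u‖ * ‖w‖))
    (fun v v' => b_add_mid u v v' w memLp_field_four) fun v => (hK u v w).trans_eq (by ring)

theorem continuous_b_right (u v : V Ω) : Continuous fun w : V Ω => b u v w := by
  obtain ⟨K, hK0, hK⟩ := exists_abs_b_le Ω
  exact continuous_of_additive_bound (C := K * (‖u‖ * ‖v‖))
    (fun w w' => b_add_right u v w w' memLp_field_four) fun w => (hK u v w).trans_eq (by ring)

/-- The trilinear form is antisymmetric in its last two arguments. -/
theorem b_add_b_swap (u v w : V Ω) : b u v w + b u w v = 0 := by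
  -- Separate continuity allows one argument at a time to be replaced by a test field.
  refine V_induction (P := fun w => b u v w + b u w v = 0)
    (isClosed_eq ((continuous_b_right u v).add (continuous_b_mid u v)) continuous_const) ?_ w
  intro w χ hχ h3 h3'
  refine V_induction (P := fun v => b u v w + b u w v = 0)
    (isClosed_eq ((continuous_b_mid u w).add (continuous_b_right u w)) continuous_const) ?_ v
  intro v ψ hψ h2 h2'
  refine V_induction (P := fun u => b u v w + b u w v = 0)
    (isClosed_eq ((continuous_b_left v w).add (continuous_b_left w v)) continuous_const) ?_ u
  intro u φ hφ h1 h1'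
  have e1 : b u v w = ∫ x in Ω, ∑ i, ∑ j, φ x j * grad ψ x (i, j) * χ x i := by
    refine integral_congr_ae ?_
    filter_upwards [h1, h2', h3] with x a1 a2 a3
    rw [a1, a2, a3]
  have e2 : b u w v = ∫ x in Ω, ∑ i, ∑ j, φ x j * grad χ x (i, j) * ψ x i := by
    refine integral_congr_ae ?_
    filter_upwards [h1, h3', h2] with x a1 a2 a3
    rw [a1, a2, a3]
  rw [e1, e2]
  exact integral_convection_test hφ hψ hχ

theorem b_self (u v : V Ω) : b u v v = 0 := by
  have := b_add_b_swap u v v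
  linarith

/-- The bound of the convection term in the dual space, in dimension two. -/
theorem exists_abs_b_self_le (Ω : Set (E 2)) : ∃ K : ℝ, 0 ≤ K ∧ ∀ u v : V Ω,
    |b u u v| ≤ K * (normH u * ‖u‖) * ‖v‖ := by
  obtain ⟨K, hK0, hK⟩ := exists_ladyzhenskaya Ω
  refine ⟨4 * K, by positivity, fun u v => ?_⟩
  -- Antisymmetry moves the derivative to v, so both L⁴ factors fall on u and Ladyzhenskaya leaves a
  -- single power of ‖u‖. With u bounded in H, the convection term is then square integrable in
  -- time.
  have e : b u u v = -b u v u := by linarith [b_add_b_swap u u v]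
  rw [e, abs_neg]
  refine (abs_b_le (memLp_field_four u) (memLp_field_four u)).trans ?_
  have h1 : norm4 u * norm4 u * normV v ≤ K * (normH u * ‖u‖) * ‖v‖ := by
    rw [← sq]
    refine mul_le_mul ((hK u).2.trans ?_) (normV_le_norm v) (normV_nonneg v)
      (mul_nonneg hK0 (mul_nonneg (normH_nonneg u) (norm_nonneg u)))
    exact mul_le_mul_of_nonneg_left
      (mul_le_mul_of_nonneg_left (normV_le_norm u) (normH_nonneg u)) hK0
  push_cast
  nlinarith

end Plane

end

/-! ### The energy identity by difference quotients -/

/-- Translations are continuous in `L²(ℝ)`. -/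
theorem tendsto_eLpNorm_translate_sub {F : Type*} [NormedAddCommGroup F] {f : ℝ → F}
    (hf : MemLp f 2 volume) :
    Tendsto (fun k : ℝ => eLpNorm (fun t => f (t + k) - f t) 2 volume) (𝓝 0) (𝓝 0) := by
  have : Fact ((2 : ℝ≥0∞) ≠ ⊤) := ⟨ENNReal.ofNat_ne_top⟩
  have h1 : Continuous fun k : ℝ => DomAddAct.mk k +ᵥ hf.toLp f :=
    (DomAddAct.continuous_mk).vadd continuous_const
  have h2 : Tendsto (fun k : ℝ => ‖(DomAddAct.mk k +ᵥ hf.toLp f) - hf.toLp f‖ₑ) (𝓝 0) (𝓝 0) := by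
    have h3 := ((h1.sub continuous_const).enorm (E := Lp F 2 (volume : Measure ℝ))).tendsto 0
      (f := fun k : ℝ => ‖(DomAddAct.mk k +ᵥ hf.toLp f) - hf.toLp f‖ₑ)
    simpa using h3
  refine h2.congr fun k => ?_
  rw [DomAddAct.mk_vadd_toLp, ← MemLp.toLp_sub, Lp.enorm_toLp]
  refine eLpNorm_congr_ae (ae_of_all _ fun t => ?_)
  simp [add_comm]

theorem eLpNorm_translate {F : Type*} [NormedAddCommGroup F] {f : ℝ → F}
    (hf : AEStronglyMeasurable f volume) (k : ℝ) :
    eLpNorm (fun t => f (t + k)) 2 volume = eLpNorm f 2 volume :=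
  eLpNorm_comp_measurePreserving hf (measurePreserving_add_right volume k)

section LionsMagenes

variable {X : Type*} [NormedAddCommGroup X] [NormedSpace ℝ X] {U : ℝ → X}
  {Γ : ℝ → StrongDual ℝ X} {N : ℝ → ℝ}

theorem eLpNorm_duality_le {v : ℝ → X} {g : ℝ → StrongDual ℝ X}
    (hg : AEStronglyMeasurable g volume) (hv : AEStronglyMeasurable v volume) :
    eLpNorm (fun t => g t (v t)) 1 volume ≤ eLpNorm g 2 volume * eLpNorm v 2 volume := by
  have := eLpNorm_le_eLpNorm_mul_eLpNorm'_of_norm (p := 2) (q := 2) (r := 1) hg hv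
    (fun (g : StrongDual ℝ X) (x : X) => g x) 1 (ae_of_all _ fun t => by
      simpa using (g t).le_opNorm (v t))
  simpa using this

/-- The integrand equals (Γ(t+k) - Γ(t))(U(t+h) + U(t)) + Γ(t)(U(t+h) - U(t)), and each term is
small by Cauchy–Schwarz in time. -/
theorem lintegral_translate_duality_le (hU : MemLp U 2 volume) (hΓ : MemLp Γ 2 volume)
    {ε : ℝ≥0∞} {h k : ℝ}
    (hk : eLpNorm (fun t => Γ (t + k) - Γ t) 2 volume ≤ ε)
    (hh : eLpNorm (fun t => U (t + h) - U t) 2 volume ≤ ε) :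
    ∫⁻ t, ‖Γ (t + k) (U (t + h) + U t) - 2 * Γ t (U t)‖ₑ ≤
      ε * (eLpNorm U 2 volume + eLpNorm U 2 volume + eLpNorm Γ 2 volume) := by
  have mU : AEStronglyMeasurable (fun t => U (t + h)) volume :=
    hU.1.comp_measurePreserving (measurePreserving_add_right volume h)
  have mΓ : AEStronglyMeasurable (fun t => Γ (t + k)) volume :=
    hΓ.1.comp_measurePreserving (measurePreserving_add_right volume k)
  have e : ∀ t, Γ (t + k) (U (t + h) + U t) - 2 * Γ t (U t) =
      (Γ (t + k) - Γ t) (U (t + h) + U t) + Γ t (U (t + h) - U t) := by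
    intro t
    simp only [sub_apply, map_add, map_sub]
    ring
  have m1 : AEStronglyMeasurable (fun t => (Γ (t + k) - Γ t) (U (t + h) + U t)) volume :=
    isBoundedBilinearMap_apply.continuous.comp_aestronglyMeasurable
      ((mΓ.sub hΓ.1).prodMk (mU.add hU.1))
  have m2 : AEStronglyMeasurable (fun t => Γ t (U (t + h) - U t)) volume :=
    isBoundedBilinearMap_apply.continuous.comp_aestronglyMeasurable
      (hΓ.1.prodMk (mU.sub hU.1))
  have hW : eLpNorm (fun t => U (t + h) + U t) 2 volume ≤
      eLpNorm U 2 volume + eLpNorm U 2 volume := by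
    refine (eLpNorm_add_le mU hU.1 one_le_two).trans_eq ?_
    rw [eLpNorm_translate hU.1]
  calc ∫⁻ t, ‖Γ (t + k) (U (t + h) + U t) - 2 * Γ t (U t)‖ₑ
      = eLpNorm ((fun t => (Γ (t + k) - Γ t) (U (t + h) + U t)) +
          fun t => Γ t (U (t + h) - U t)) 1 volume := by
        rw [eLpNorm_one_eq_lintegral_enorm]
        simp only [e, Pi.add_apply]
    _ ≤ _ := eLpNorm_add_le m1 m2 le_rfl
    _ ≤ ε * (eLpNorm U 2 volume + eLpNorm U 2 volume) + eLpNorm Γ 2 volume * ε :=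
        add_le_add ((eLpNorm_duality_le (mΓ.sub hΓ.1) (mU.add hU.1)).trans (mul_le_mul' hk hW))
          ((eLpNorm_duality_le hΓ.1 (mU.sub hU.1)).trans (mul_le_mul' le_rfl hh))
    _ = _ := by ring

theorem intervalIntegrable_duality (hΓ : MemLp Γ 2 volume) (x : X) (s t : ℝ) :
    IntervalIntegrable (fun r => Γ r x) volume s t := by
  rw [intervalIntegrable_iff]
  have : IsFiniteMeasure ((volume : Measure ℝ).restrict (uIoc s t)) := ⟨by simp [uIoc]⟩
  have h1 : IntegrableOn Γ (uIoc s t) := by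
    rw [IntegrableOn, ← memLp_one_iff_integrable]
    exact (hΓ.restrict _).mono_exponent one_le_two
  exact (ContinuousLinearMap.apply ℝ ℝ x).integrable_comp h1

/-- With r = t + hθ the difference quotient becomes an average over θ ∈ (0,1) of pairings with Γ(t +
hθ). After Tonelli, for which strong measurability gives joint measurability, the translation
estimate holds uniformly in θ. -/
theorem enorm_integral_difference_quotient_le (hU : MemLp U 2 volume) (hΓ : MemLp Γ 2 volume)
    (sU : StronglyMeasurable U) (sΓ : StronglyMeasurable Γ)
    {ε : ℝ≥0∞} {h a b : ℝ} (hab : a ≤ b) (hh : 0 < h)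
    (hk : ∀ k ∈ Ioc 0 h, eLpNorm (fun t => Γ (t + k) - Γ t) 2 volume ≤ ε ∧
      eLpNorm (fun t => U (t + k) - U t) 2 volume ≤ ε)
    (H : ∀ᵐ t, t ∈ Ioc a b → N (t + h) - N t = ∫ r in t..t + h, Γ r (U (t + h) + U t)) :
    ‖∫ t in a..b, (h⁻¹ * (N (t + h) - N t) - 2 * Γ t (U t))‖ₑ ≤
      ε * (eLpNorm U 2 volume + eLpNorm U 2 volume + eLpNorm Γ 2 volume) := by
  set D : ℝ → ℝ → ℝ := fun t θ => Γ (t + h * θ) (U (t + h) + U t) - 2 * Γ t (U t) with hD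
  have mD : Measurable fun p : ℝ × ℝ => ‖D p.1 p.2‖ₑ := by
    have m1 : StronglyMeasurable fun p : ℝ × ℝ => Γ (p.1 + h * p.2) :=
      sΓ.comp_measurable (by fun_prop)
    have m2 : StronglyMeasurable fun p : ℝ × ℝ => U (p.1 + h) + U p.1 :=
      (sU.comp_measurable (by fun_prop)).add (sU.comp_measurable (by fun_prop))
    have m3 : StronglyMeasurable fun p : ℝ × ℝ => Γ p.1 (U p.1) :=
      isBoundedBilinearMap_apply.continuous.comp_stronglyMeasurable
        ((sΓ.comp_measurable measurable_fst).prodMk (sU.comp_measurable measurable_fst))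
    have m4 : StronglyMeasurable fun p : ℝ × ℝ => Γ (p.1 + h * p.2) (U (p.1 + h) + U p.1) :=
      isBoundedBilinearMap_apply.continuous.comp_stronglyMeasurable (m1.prodMk m2)
    exact (m4.sub (m3.const_mul 2)).enorm
  have hDint : ∀ t, t ∈ Ioc a b → N (t + h) - N t = ∫ r in t..t + h, Γ r (U (t + h) + U t) →
      h⁻¹ * (N (t + h) - N t) - 2 * Γ t (U t) = ∫ θ in Ioc (0 : ℝ) 1, D t θ := by
    intro t _ ht
    have i1 : IntervalIntegrable (fun θ => Γ (t + h * θ) (U (t + h) + U t)) volume 0 1 := by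
      have := ((intervalIntegrable_duality hΓ (U (t + h) + U t) t (t + h)).comp_add_left
        t).comp_mul_left (c := h)
      simpa [hh.ne'] using this
    rw [← intervalIntegral.integral_of_le zero_le_one, hD,
      intervalIntegral.integral_sub i1 intervalIntegrable_const,
      intervalIntegral.integral_comp_add_mul (fun r => Γ r (U (t + h) + U t)) hh.ne', ht]
    simp
  rw [intervalIntegral.integral_of_le hab]
  calc _ ≤ ∫⁻ t in Ioc a b, ‖h⁻¹ * (N (t + h) - N t) - 2 * Γ t (U t)‖ₑ :=
        enorm_integral_le_lintegral_enorm _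
    _ ≤ ∫⁻ t in Ioc a b, ∫⁻ θ in Ioc (0 : ℝ) 1, ‖D t θ‖ₑ := by
        refine lintegral_mono_ae ?_
        rw [ae_restrict_iff' measurableSet_Ioc]
        filter_upwards [H] with t ht htm
        rw [hDint t htm (ht htm)]
        exact enorm_integral_le_lintegral_enorm _
    _ ≤ ∫⁻ t, ∫⁻ θ in Ioc (0 : ℝ) 1, ‖D t θ‖ₑ := setLIntegral_le_lintegral _ _
    _ = ∫⁻ θ in Ioc (0 : ℝ) 1, ∫⁻ t, ‖D t θ‖ₑ := lintegral_lintegral_swap mD.aemeasurable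
    _ ≤ ∫⁻ _θ in Ioc (0 : ℝ) 1,
        ε * (eLpNorm U 2 volume + eLpNorm U 2 volume + eLpNorm Γ 2 volume) := by
        refine setLIntegral_mono' measurableSet_Ioc fun θ hθ => ?_
        refine lintegral_translate_duality_le hU hΓ (hk (h * θ) ⟨by nlinarith [hθ.1], ?_⟩).1
          (hk h ⟨hh, le_rfl⟩).2
        nlinarith [hθ.2]
    _ = _ := by simp

/-- The energy identity for a function whose square is differentiable along the duality pairing. -/
theorem ae_sub_eq_integral_of_stronglyMeasurable (hU : MemLp U 2 volume) (hΓ : MemLp Γ 2 volume)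
    (sU : StronglyMeasurable U) (sΓ : StronglyMeasurable Γ) (hN : LocallyIntegrable N volume)
    {A B : ℝ} (H : ∀ h > 0, ∀ᵐ t, t ∈ Ioo A (B - h) →
      N (t + h) - N t = ∫ r in t..t + h, Γ r (U (t + h) + U t)) :
    ∀ᵐ a, a ∈ Ioo A B → ∀ᵐ b, b ∈ Ioo a B → N b - N a = 2 * ∫ r in a..b, Γ r (U r) := by
  have hΓU : Integrable (fun t => Γ t (U t)) volume := by
    rw [← memLp_one_iff_integrable]
    refine ⟨isBoundedBilinearMap_apply.continuous.comp_aestronglyMeasurable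
      (hΓ.1.prodMk hU.1), (eLpNorm_duality_le hΓ.1 hU.1).trans_lt ?_⟩
    exact ENNReal.mul_lt_top hΓ.2 hU.2
  have hNi : ∀ s t, IntervalIntegrable N volume s t := fun s t =>
    intervalIntegrable_iff.2 ((hN.integrableOn_isCompact isCompact_uIcc).mono_set
      uIoc_subset_uIcc)
  have hNh : ∀ h s t, IntervalIntegrable (fun r => N (r + h)) volume s t := fun h s t => by
    have := (hNi (s + h) (t + h)).comp_add_right h
    simpa using this
  -- Both endpoints are points where the primitive of N has derivative N.
  filter_upwards [LocallyIntegrable.ae_hasDerivAt_integral hN] with a ha haA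
  filter_upwards [LocallyIntegrable.ae_hasDerivAt_integral hN] with b hb hbB
  have L1 : ∀ x, HasDerivAt (fun y => ∫ r in x..y, N r) (N x) x →
      Tendsto (fun h => h⁻¹ * ∫ r in x..x + h, N r) (𝓝[>] 0) (𝓝 (N x)) := by
    intro x hx
    have := hx.tendsto_slope_zero_right
    simpa using this
  -- The integrated difference quotient telescopes into averages of N just after b and just after a,
  -- which converge to N b and N a.
  have e1 : ∀ h, ∫ t in a..b, (h⁻¹ * (N (t + h) - N t) - 2 * Γ t (U t)) =
      (h⁻¹ * ∫ r in b..b + h, N r) - (h⁻¹ * ∫ r in a..a + h, N r) -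
        2 * ∫ r in a..b, Γ r (U r) := by
    intro h
    rw [intervalIntegral.integral_sub (((hNh h a b).sub (hNi a b)).const_mul _)
      (hΓU.intervalIntegrable.const_mul 2), intervalIntegral.integral_const_mul,
      intervalIntegral.integral_const_mul, intervalIntegral.integral_sub (hNh h a b) (hNi a b),
      intervalIntegral.integral_comp_add_right, ← mul_sub]
    have j1 := intervalIntegral.integral_add_adjacent_intervals (hNi a (a + h)) (hNi (a + h) (b + h))
    have j2 := intervalIntegral.integral_add_adjacent_intervals (hNi a b) (hNi b (b + h))
    congr 2
    linarith
  have L2 : Tendsto (fun h => ‖∫ t in a..b, (h⁻¹ * (N (t + h) - N t) - 2 * Γ t (U t))‖ₑ)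
      (𝓝[>] 0) (𝓝 ‖N b - N a - 2 * ∫ r in a..b, Γ r (U r)‖ₑ) := by
    simp_rw [e1]
    exact (((L1 b (hb b)).sub (L1 a (ha a))).sub_const _).enorm
  have L3 : Tendsto (fun h => ‖∫ t in a..b, (h⁻¹ * (N (t + h) - N t) - 2 * Γ t (U t))‖ₑ)
      (𝓝[>] 0) (𝓝 0) := by
    rw [ENNReal.tendsto_nhds_zero]
    intro ε hε
    set C := eLpNorm U 2 volume + eLpNorm U 2 volume + eLpNorm Γ 2 volume with hC
    have hCt : C ≠ ⊤ := by simp [hC, hU.2.ne, hΓ.2.ne]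
    have hε' : 0 < ε / (C + 1) := ENNReal.div_pos hε.ne' (by simp [hCt])
    have hev := (ENNReal.tendsto_nhds_zero.1 (tendsto_eLpNorm_translate_sub hΓ) _ hε').and
      (ENNReal.tendsto_nhds_zero.1 (tendsto_eLpNorm_translate_sub hU) _ hε')
    obtain ⟨δ, hδ, hev⟩ := Metric.eventually_nhds_iff.1 hev
    -- The bound h < B - b keeps t + h below B for all t ≤ b, as `H` requires.
    have hmem : Ioo 0 (min δ (B - b)) ∈ 𝓝[>] (0 : ℝ) :=
      Ioo_mem_nhdsGT (lt_min hδ (by linarith [hbB.2]))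
    filter_upwards [hmem] with h hh
    refine (enorm_integral_difference_quotient_le hU hΓ sU sΓ hbB.1.le hh.1 (fun k hk => ?_)
      ?_).trans (b := ε / (C + 1) * C) ?_
    · refine hev ?_
      rw [dist_zero_right, Real.norm_of_nonneg hk.1.le]
      exact hk.2.trans_lt (hh.2.trans_le (min_le_left _ _))
    · filter_upwards [H h hh.1] with t ht htm
      refine ht ⟨haA.1.trans htm.1, ?_⟩
      have := hh.2.trans_le (min_le_right _ _)
      linarith [htm.2]
    · calc ε / (C + 1) * C ≤ ε / (C + 1) * (C + 1) := by gcongr; exact le_self_add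
        _ ≤ ε := (ENNReal.div_mul_cancel (by simp) (by simp [hCt])).le
  have h0 := tendsto_nhds_unique L2 L3
  rw [enorm_eq_zero, sub_eq_zero] at h0
  exact h0

end LionsMagenes

/-! ### From distributional derivatives to increments -/

section TimeDerivative

/-- A smooth approximation, as `ε → 0`, of the indicator function of `(s, t]`. -/
def smoothWindow (s t ε r : ℝ) : ℝ :=
  Real.smoothTransition ((r - s) / ε) - Real.smoothTransition ((r - t) / ε)

theorem contDiff_smoothWindow (s t ε : ℝ) : ContDiff ℝ ∞ (smoothWindow s t ε) := by
  have h : ∀ x : ℝ, ContDiff ℝ ∞ fun r : ℝ => Real.smoothTransition ((r - x) / ε) := fun x =>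
    Real.smoothTransition.contDiff.comp ((contDiff_id.sub contDiff_const).div_const ε)
  exact (h s).sub (h t)

theorem abs_smoothWindow_le_one (s t ε r : ℝ) : |smoothWindow s t ε r| ≤ 1 := by
  rw [smoothWindow, abs_le]
  constructor <;> linarith [Real.smoothTransition.le_one ((r - s) / ε),
    Real.smoothTransition.le_one ((r - t) / ε), Real.smoothTransition.nonneg ((r - s) / ε),
    Real.smoothTransition.nonneg ((r - t) / ε)]

variable {s t ε : ℝ}

theorem smoothTransition_div_eq_one {x r : ℝ} (hε : 0 < ε) (h : x + ε ≤ r) :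
    Real.smoothTransition ((r - x) / ε) = 1 :=
  Real.smoothTransition.one_of_one_le (by rw [le_div_iff₀ hε]; linarith)

theorem smoothTransition_div_eq_zero {x r : ℝ} (hε : 0 < ε) (h : r ≤ x) :
    Real.smoothTransition ((r - x) / ε) = 0 :=
  Real.smoothTransition.zero_of_nonpos (div_nonpos_of_nonpos_of_nonneg (by linarith) hε.le)

theorem support_smoothWindow_subset (hst : s < t) (hε : 0 < ε) :
    Function.support (smoothWindow s t ε) ⊆ Icc s (t + ε) := by
  intro r hr
  by_contra h
  rw [mem_Icc, not_and_or, not_le, not_le] at h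
  refine hr ?_
  rcases h with h | h
  · rw [smoothWindow, smoothTransition_div_eq_zero hε h.le,
      smoothTransition_div_eq_zero hε (h.le.trans hst.le), sub_zero]
  · rw [smoothWindow, smoothTransition_div_eq_one hε (by linarith),
      smoothTransition_div_eq_one hε h.le, sub_self]

theorem tsupport_smoothWindow_subset (hst : s < t) (hε : 0 < ε) :
    tsupport (smoothWindow s t ε) ⊆ Icc s (t + ε) :=
  closure_minimal (support_smoothWindow_subset hst hε) isClosed_Icc

theorem tendsto_smoothWindow (hst : s < t) (r : ℝ) :
    Tendsto (fun ε => smoothWindow s t ε r) (𝓝[>] 0) (𝓝 ((Ioc s t).indicator 1 r)) := by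
  have key : ∀ x : ℝ, Tendsto (fun ε => Real.smoothTransition ((r - x) / ε)) (𝓝[>] 0)
      (𝓝 ((Ioi x).indicator 1 r)) := by
    intro x
    refine tendsto_const_nhds.congr' ?_
    rcases le_or_gt r x with h | h
    · filter_upwards [self_mem_nhdsWithin] with ε hε
      rw [smoothTransition_div_eq_zero hε h, indicator_of_notMem (by simpa using h)]
    · filter_upwards [Ioo_mem_nhdsGT (sub_pos.2 h)] with ε hε
      rw [smoothTransition_div_eq_one hε.1 (by linarith [hε.2]), indicator_of_mem (by simpa using h)]
      rfl
  have e : (Ioc s t).indicator (1 : ℝ → ℝ) r =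
      (Ioi s).indicator 1 r - (Ioi t).indicator 1 r := by
    simp only [indicator, mem_Ioc, mem_Ioi, Pi.one_apply]
    grind
  rw [e]
  exact (key s).sub (key t)

/-- The regularized evaluation at time `x`. -/
def smoothEval (P : ℝ → ℝ) (x ε : ℝ) : ℝ :=
  ∫ y in Icc (0 : ℝ) 1, deriv Real.smoothTransition y * P (x + ε * y)

theorem continuous_deriv_smoothTransition : Continuous (deriv Real.smoothTransition) :=
  (Real.smoothTransition.contDiff (n := 1)).continuous_deriv le_rfl

theorem deriv_smoothTransition_eq_zero {y : ℝ} (hy : y ∉ Icc (0 : ℝ) 1) :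
    deriv Real.smoothTransition y = 0 := by
  rw [mem_Icc, not_and_or, not_le, not_le] at hy
  rcases hy with h | h
  · have : Real.smoothTransition =ᶠ[𝓝 y] fun _ => 0 := by
      filter_upwards [Iio_mem_nhds h] with z hz
      exact Real.smoothTransition.zero_of_nonpos (le_of_lt hz)
    rw [this.deriv_eq, deriv_const]
  · have : Real.smoothTransition =ᶠ[𝓝 y] fun _ => 1 := by
      filter_upwards [Ioi_mem_nhds h] with z hz
      exact Real.smoothTransition.one_of_one_le (le_of_lt hz)
    rw [this.deriv_eq, deriv_const]

/-- The kernel has mass one, so the value at ε = 0 is P x, and the integral is continuous in ε. -/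
theorem tendsto_smoothEval {P : ℝ → ℝ} (hP : Continuous P) (x : ℝ) :
    Tendsto (smoothEval P x) (𝓝[>] 0) (𝓝 (P x)) := by
  have h1 : Continuous fun ε => ∫ y in Icc (0 : ℝ) 1, deriv Real.smoothTransition y *
      P (x + ε * y) := by
    have hf : Continuous (Function.uncurry fun ε y : ℝ => deriv Real.smoothTransition y *
        P (x + ε * y)) :=
      (continuous_deriv_smoothTransition.comp continuous_snd).mul (hP.comp (by fun_prop))
    exact continuous_parametric_integral_of_continuous hf isCompact_Icc
  have h2 : smoothEval P x 0 = P x := by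
    have h3 : ∫ y in (0 : ℝ)..1, deriv Real.smoothTransition y = 1 := by
      rw [intervalIntegral.integral_deriv_eq_sub
        (fun y _ => (Real.smoothTransition.contDiff (n := 1)).differentiable one_ne_zero y)
        (continuous_deriv_smoothTransition.intervalIntegrable _ _)]
      simp
    rw [smoothEval, integral_Icc_eq_integral_Ioc, ← intervalIntegral.integral_of_le zero_le_one]
    simp only [zero_mul, add_zero]
    rw [intervalIntegral.integral_mul_const, h3, one_mul]
  have h4 := h1.tendsto 0
  rw [← h2]
  exact h4.mono_left nhdsWithin_le_nhds

theorem integral_deriv_smoothTransition_mul {P : ℝ → ℝ} (x : ℝ) (hε : 0 < ε) :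
    ∫ r, ε⁻¹ * deriv Real.smoothTransition ((r - x) / ε) * P r = smoothEval P x ε := by
  rw [smoothEval, setIntegral_eq_integral_of_forall_compl_eq_zero
    fun y hy => by rw [deriv_smoothTransition_eq_zero hy, zero_mul]]
  set F : ℝ → ℝ := fun r => deriv Real.smoothTransition ((r - x) / ε) * P r with hF
  have e1 : ∀ y, deriv Real.smoothTransition y * P (x + ε * y) = F (x + ε * y) := by
    intro y
    simp only [hF]
    rw [add_sub_cancel_left, mul_div_cancel_left₀ _ hε.ne']
  simp_rw [e1]
  rw [Measure.integral_comp_mul_left (fun y => F (x + y)) ε, integral_add_left_eq_self F x,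
    abs_of_pos (inv_pos.2 hε), smul_eq_mul, ← integral_const_mul]
  simp only [hF, mul_assoc]

theorem deriv_smoothWindow (r : ℝ) : deriv (smoothWindow s t ε) r =
    ε⁻¹ * deriv Real.smoothTransition ((r - s) / ε) -
      ε⁻¹ * deriv Real.smoothTransition ((r - t) / ε) := by
  have h : ∀ x : ℝ, HasDerivAt (fun r : ℝ => Real.smoothTransition ((r - x) / ε))
      (ε⁻¹ * deriv Real.smoothTransition ((r - x) / ε)) r := by
    intro x
    have h1 : HasDerivAt (fun r : ℝ => (r - x) / ε) (ε⁻¹) r := by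
      simpa using ((hasDerivAt_id r).sub_const x).div_const ε
    have h2 := ((Real.smoothTransition.contDiff (n := 1)).differentiable one_ne_zero
      ((r - x) / ε)).hasDerivAt.comp r h1
    rw [mul_comm]
    exact h2
  exact ((h s).sub (h t)).deriv

/-- A continuous function with a locally integrable distributional derivative on `(0, ∞)` is the
primitive of that derivative. -/
theorem sub_eq_integral_of_distributional_deriv {P q : ℝ → ℝ} (hP : ContinuousOn P (Ici 0))
    (hq : LocallyIntegrableOn q (Ioi 0))
    (H : ∀ ψ : ℝ → ℝ, ContDiff ℝ ∞ ψ → HasCompactSupport ψ → tsupport ψ ⊆ Ioi 0 →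
      ∫ r in Ioi (0 : ℝ), deriv ψ r * P r = -∫ r in Ioi (0 : ℝ), ψ r * q r)
    (hs : 0 < s) (hst : s < t) : P t - P s = ∫ r in s..t, q r := by
  -- Extension of P by the constant P 0, continuous on the whole line, so that the smooth
  -- evaluations are defined everywhere.
  set Q : ℝ → ℝ := fun r => P (max r 0) with hQ
  have hQc : Continuous Q := by
    rw [← continuousOn_univ]
    exact hP.comp (by fun_prop) fun r _ => le_max_right r 0
  have hQP : ∀ r, 0 ≤ r → Q r = P r := fun r hr => by simp only [hQ, max_eq_left hr]
  have hqI : IntegrableOn q (Icc s (t + 1)) :=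
    hq.integrableOn_compact_subset (fun r hr => hs.trans_le hr.1) isCompact_Icc
  -- The derivative of the window is a bump of mass one just after s minus one just after t: testing
  -- with it gives P s - P t in the limit.
  have lhs : ∀ ε, 0 < ε → ∫ r in Ioi (0 : ℝ), deriv (smoothWindow s t ε) r * P r =
      smoothEval Q s ε - smoothEval Q t ε := by
    intro ε hε
    have hz : ∀ x, 0 < x → ∀ r, r ∉ Ioi (0 : ℝ) → deriv Real.smoothTransition ((r - x) / ε) = 0 := by
      intro x hx r hr
      refine deriv_smoothTransition_eq_zero fun h => ?_
      have h1 := h.1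
      rw [le_div_iff₀ hε] at h1
      exact hr (show 0 < r by linarith)
    have hi : ∀ x, Integrable fun r =>
        ε⁻¹ * deriv Real.smoothTransition ((r - x) / ε) * Q r := by
      intro x
      refine Continuous.integrable_of_hasCompactSupport ?_ ?_
      · exact (continuous_const.mul (continuous_deriv_smoothTransition.comp (by fun_prop))).mul hQc
      · refine HasCompactSupport.of_support_subset_isCompact (isCompact_Icc (a := x) (b := x + ε)) ?_
        intro r hr
        by_contra h
        refine hr ?_
        have : (r - x) / ε ∉ Icc (0 : ℝ) 1 := by
          rw [mem_Icc, le_div_iff₀ hε, div_le_iff₀ hε]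
          rw [mem_Icc] at h
          intro h'
          exact h ⟨by linarith [h'.1], by linarith [h'.2]⟩
        simp only [deriv_smoothTransition_eq_zero this, mul_zero, zero_mul]
    calc _ = ∫ r in Ioi (0 : ℝ), (ε⁻¹ * deriv Real.smoothTransition ((r - s) / ε) * Q r -
          ε⁻¹ * deriv Real.smoothTransition ((r - t) / ε) * Q r) := by
          refine setIntegral_congr_fun measurableSet_Ioi fun r hr => ?_
          rw [deriv_smoothWindow, hQP r (le_of_lt hr), sub_mul]
      _ = ∫ r, (ε⁻¹ * deriv Real.smoothTransition ((r - s) / ε) * Q r -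
          ε⁻¹ * deriv Real.smoothTransition ((r - t) / ε) * Q r) := by
          refine setIntegral_eq_integral_of_forall_compl_eq_zero fun r hr => ?_
          rw [hz s hs r hr, hz t (hs.trans hst) r hr]
          simp
      _ = _ := by
          rw [integral_sub (hi s) (hi t), integral_deriv_smoothTransition_mul s hε,
            integral_deriv_smoothTransition_mul t hε]
  have L1 : Tendsto (fun ε => smoothEval Q s ε - smoothEval Q t ε) (𝓝[>] 0) (𝓝 (P s - P t)) := by
    rw [← hQP s hs.le, ← hQP t (hs.trans hst).le]
    exact (tendsto_smoothEval hQc s).sub (tendsto_smoothEval hQc t)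
  have hsub : Ioc s t ⊆ Ioi 0 := fun r hr => hs.trans hr.1
  have L2 : Tendsto (fun ε => ∫ r in Ioi (0 : ℝ), smoothWindow s t ε r * q r) (𝓝[>] 0)
      (𝓝 (∫ r in Ioi (0 : ℝ), (Ioc s t).indicator 1 r * q r)) := by
    refine tendsto_integral_filter_of_dominated_convergence
      ((Icc s (t + 1)).indicator fun r => ‖q r‖) ?_ ?_ ?_ ?_
    · exact Eventually.of_forall fun ε =>
        (contDiff_smoothWindow s t ε).continuous.aestronglyMeasurable.mul hq.aestronglyMeasurable
    · filter_upwards [Ioo_mem_nhdsGT (zero_lt_one' ℝ)] with ε hε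
      refine ae_of_all _ fun r => ?_
      by_cases hr : r ∈ Icc s (t + 1)
      · rw [indicator_of_mem hr, norm_mul]
        exact mul_le_of_le_one_left (norm_nonneg _) (abs_smoothWindow_le_one s t ε r)
      · have : smoothWindow s t ε r = 0 := by
          by_contra h
          have := support_smoothWindow_subset hst hε.1 h
          exact hr ⟨this.1, this.2.trans (by linarith [hε.2])⟩
        rw [this, zero_mul, norm_zero]
        exact indicator_nonneg (fun _ _ => norm_nonneg _) r
    · exact (IntegrableOn.integrable_indicator (f := fun r => ‖q r‖) hqI.norm
        measurableSet_Icc).integrableOn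
    · exact ae_of_all _ fun r => (tendsto_smoothWindow hst r).mul_const _
  have e : ∫ r in Ioi (0 : ℝ), (Ioc s t).indicator 1 r * q r = ∫ r in s..t, q r := by
    rw [intervalIntegral.integral_of_le hst.le]
    have : ∀ r, (Ioc s t).indicator (1 : ℝ → ℝ) r * q r = (Ioc s t).indicator q r := by
      intro r
      by_cases hr : r ∈ Ioc s t <;> simp [hr]
    simp_rw [this]
    rw [setIntegral_indicator measurableSet_Ioc, inter_eq_right.2 hsub]
  have L3 : Tendsto (fun ε => smoothEval Q s ε - smoothEval Q t ε) (𝓝[>] 0)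
      (𝓝 (-∫ r in s..t, q r)) := by
    rw [← e]
    refine L2.neg.congr' ?_
    filter_upwards [self_mem_nhdsWithin] with ε hε
    have hts := tsupport_smoothWindow_subset hst (show 0 < ε from hε)
    rw [← lhs ε hε, H (smoothWindow s t ε) (contDiff_smoothWindow s t ε)
      (isCompact_Icc.of_isClosed_subset (isClosed_tsupport _) hts)
      (hts.trans fun r hr => hs.trans_le hr.1)]
  have := tendsto_nhds_unique L1 L3
  linarith

end TimeDerivative

/-! ### Integrability in time, and the energy inequality in dimension two -/

instance secondCountable_V {d : ℕ} (Ω : Set (E d)) : SecondCountableTopology (V Ω) := by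
  have : Fact ((2 : ℝ≥0∞) ≠ ⊤) := ⟨ENNReal.ofNat_ne_top⟩
  have : SecondCountableTopology (L2 Ω (E d)) := inferInstance
  have : SecondCountableTopology (L2 Ω (G d)) := inferInstance
  have : SecondCountableTopology (Pairs Ω) :=
    (WithLp.prodContinuousLinearEquiv 2 ℝ (L2 Ω (E d)) (L2 Ω (G d))).toHomeomorph
      |>.secondCountableTopology
  exact inferInstanceAs (SecondCountableTopology (VSub Ω))

section Integrability

variable {d : ℕ} {Ω : Set (E d)} {f : ℝ → V' Ω} {u : ℝ → V Ω} {s : Set ℝ}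

theorem integrableOn_duality (hf : MemLp f 2 (volume.restrict s))
    (hu : MemLp u 2 (volume.restrict s)) : IntegrableOn (fun t => f t (u t)) s := by
  rw [IntegrableOn, ← memLp_one_iff_integrable]
  refine MemLp.of_bilin (p := 2) (q := 2) (fun (g : V' Ω) (v : V Ω) => g v) 1 hf hu
    (isBoundedBilinearMap_apply.continuous.comp_aestronglyMeasurable (hf.1.prodMk hu.1))
    (ae_of_all _ fun t => ?_)
  rw [one_mul]
  exact (f t).le_opNorm (u t)

theorem integrableOn_normV_sq (hu : MemLp u 2 (volume.restrict s)) :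
    IntegrableOn (fun t => normV (u t) ^ 2) s :=
  ((gradientL Ω).comp_memLp' hu).integrable_norm_pow two_ne_zero

theorem integrableOn_normH_sq (hu : MemLp u 2 (volume.restrict s)) :
    IntegrableOn (fun t => normH (u t) ^ 2) s :=
  ((fieldL Ω).comp_memLp' hu).integrable_norm_pow two_ne_zero

theorem integrableOn_viscosity_mul {ν D : ℝ → ℝ} {νup S : ℝ} (hν : IntegrableOn ν (Ioc 0 S))
    (h0 : ∀ t ∈ Ioi (0 : ℝ), 0 ≤ ν t) (hup : ∀ t ∈ Ioi (0 : ℝ), ν t ≤ νup)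
    (hD : IntegrableOn D (Ioc 0 S)) : IntegrableOn (fun t => ν t * D t) (Ioc 0 S) := by
  refine Integrable.bdd_mul (c := νup) hD hν.aestronglyMeasurable ?_
  filter_upwards [ae_restrict_mem measurableSet_Ioc] with t ht
  rw [Real.norm_eq_abs, abs_of_nonneg (h0 t ht.1)]
  exact hup t ht.1

end Integrability

theorem a_self {d : ℕ} {Ω : Set (E d)} (v : V Ω) : a v v = normV v ^ 2 :=
  real_inner_self_eq_norm_sq _

theorem continuous_a_right {d : ℕ} {Ω : Set (E d)} (u : V Ω) : Continuous fun v : V Ω => a u v :=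
  continuous_const.inner continuous_gradient

theorem abs_a_le {d : ℕ} {Ω : Set (E d)} (u v : V Ω) : |a u v| ≤ ‖u‖ * ‖v‖ :=
  (abs_real_inner_le_norm _ _).trans
    (mul_le_mul (normV_le_norm u) (normV_le_norm v) (norm_nonneg _) (norm_nonneg _))

/-- The increments of a weak solution are the integrals of its time derivative. -/
theorem inner_sub_eq_integral {d : ℕ} {Ω : Set (E d)} {u : ℝ → V Ω} {g : ℝ → V' Ω} {w : ℝ → H Ω}
    (hw : ∀ᵐ t ∂volume.restrict (Ioi 0), (w t : L2 Ω (E d)) = field (u t))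
    (hc : ∀ h : H Ω, ContinuousOn (fun t => (inner ℝ (w t) h : ℝ)) (Ici 0))
    (hg : LocallyIntegrableOn g (Ioi 0)) (hgd : IsTimeDeriv u g) (v : V Ω)
    {s t : ℝ} (hs : 0 < s) (hst : s < t) :
    inner ℝ (w t : L2 Ω (E d)) (field v) - inner ℝ (w s : L2 Ω (E d)) (field v) =
      ∫ r in s..t, g r v := by
  refine sub_eq_integral_of_distributional_deriv
    (P := fun t => inner ℝ (w t : L2 Ω (E d)) (field v)) (q := fun r => g r v)
    (hc ⟨field v, field_mem_H v⟩) ?_ ?_ hs hst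
  · intro x hx
    obtain ⟨S, hS, hi⟩ := hg x hx
    exact ⟨S, hS, (ContinuousLinearMap.apply ℝ ℝ v).integrable_comp hi⟩
  · intro ψ h1 h2 h3
    rw [← hgd ψ h1 h2 h3 v]
    refine integral_congr_ae ?_
    filter_upwards [hw] with r hr
    rw [hr]

theorem memLp_indicator_of_restrict {F : Type*} [NormedAddCommGroup F] {v : ℝ → F} {s : Set ℝ}
    (hs : MeasurableSet s) (hv : MemLp v 2 (volume.restrict s)) : MemLp (s.indicator v) 2 volume :=
  (memLp_indicator_iff_restrict hs).2 hv

/-- The energy identity for functions with square integrable time derivative in the dual space. -/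
theorem ae_norm_sq_sub_eq_integral_duality {X Y : Type*} [NormedAddCommGroup X] [NormedSpace ℝ X]
    [NormedAddCommGroup Y] [InnerProductSpace ℝ Y] (ι : X →L[ℝ] Y) {g : ℝ → StrongDual ℝ X}
    {u : ℝ → X} {w : ℝ → Y}
    {S : ℝ} (hu : MemLp u 2 (volume.restrict (Ioc 0 S)))
    (hg : MemLp g 2 (volume.restrict (Ioc 0 S)))
    (hw : ∀ᵐ t ∂volume.restrict (Ioi 0), w t = ι (u t))
    (hwg : ∀ (v : X) (s t : ℝ), 0 < s → s < t →
      inner ℝ (w t) (ι v) - inner ℝ (w s) (ι v) =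
        ∫ r in s..t, g r v) :
    ∀ᵐ s, s ∈ Ioo 0 S → ∀ᵐ t, t ∈ Ioo s S →
      ‖ι (u t)‖ ^ 2 - ‖ι (u s)‖ ^ 2 = 2 * ∫ r in s..t, g r (u r) := by
  -- Everything is cut off to (0, S], because the translation argument lives on the whole line.
  set N : ℝ → ℝ := (Ioc 0 S).indicator fun t => ‖ι (u t)‖ ^ 2 with hN
  have hNi : Integrable N := (integrable_indicator_iff measurableSet_Ioc).2
    ((ι.comp_memLp' hu).integrable_norm_pow two_ne_zero)
  have hNe : ∀ t ∈ Ioc 0 S, N t = ‖ι (u t)‖ ^ 2 := fun t ht => by simp only [hN, indicator_of_mem ht]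
  have hU := memLp_indicator_of_restrict measurableSet_Ioc hu
  have hΓ := memLp_indicator_of_restrict measurableSet_Ioc hg
  obtain ⟨U, sU, hUU⟩ := hU.1
  obtain ⟨Γ, sΓ, hΓΓ⟩ := hΓ.1
  have hU' : MemLp U 2 volume := (memLp_congr_ae hUU).1 hU
  have hΓ' : MemLp Γ 2 volume := (memLp_congr_ae hΓΓ).1 hΓ
  have eU : ∀ᵐ t, t ∈ Ioc 0 S → U t = u t := by
    filter_upwards [hUU] with t ht htS
    rw [← ht, indicator_of_mem htS]
  have eΓ : ∀ᵐ t, t ∈ Ioc 0 S → Γ t = g t := by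
    filter_upwards [hΓΓ] with t ht htS
    rw [← ht, indicator_of_mem htS]
  have eW : ∀ᵐ t, t ∈ Ioc 0 S → w t = ι (u t) := by
    filter_upwards [(ae_restrict_iff' measurableSet_Ioi).1 hw] with t ht htS
    exact ht htS.1
  -- The increment w(t+h) - w(t) is tested with u(t+h) + u(t), which is fixed in r; the cross terms
  -- cancel by symmetry.
  have H : ∀ h > 0, ∀ᵐ t, t ∈ Ioo 0 (S - h) →
      N (t + h) - N t = ∫ r in t..t + h, Γ r (U (t + h) + U t) := by
    intro h hh
    have shift : ∀ {p : ℝ → Prop}, (∀ᵐ t, p t) → ∀ᵐ t, p (t + h) := fun hp =>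
      (measurePreserving_add_right volume h).quasiMeasurePreserving.ae hp
    filter_upwards [eU, shift eU, eW, shift eW] with t u1 u2 w1 w2 ht
    have m1 : t ∈ Ioc 0 S := ⟨ht.1, by linarith [ht.2]⟩
    have m2 : t + h ∈ Ioc 0 S := ⟨by linarith [ht.1], by linarith [ht.2]⟩
    rw [hNe _ m2, hNe _ m1, u1 m1, u2 m2]
    have e1 : ∫ r in t..t + h, Γ r (u (t + h) + u t) = ∫ r in t..t + h, g r (u (t + h) + u t) := by
      refine intervalIntegral.integral_congr_ae ?_
      filter_upwards [eΓ] with r hr hrm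
      rw [uIoc_of_le (by linarith)] at hrm
      rw [hr ⟨ht.1.trans hrm.1, hrm.2.trans m2.2⟩]
    rw [e1, ← hwg (u (t + h) + u t) t (t + h) ht.1 (by linarith), w1 m1, w2 m2, map_add,
      inner_add_right, inner_add_right, real_inner_self_eq_norm_sq, real_inner_self_eq_norm_sq,
      real_inner_comm (ι (u t))]
    ring
  have main := ae_sub_eq_integral_of_stronglyMeasurable hU' hΓ' sU sΓ hNi.locallyIntegrable H
  filter_upwards [main] with s hs hsS
  filter_upwards [hs hsS] with t ht htS
  have ms : s ∈ Ioc 0 S := ⟨hsS.1, hsS.2.le⟩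
  have mt : t ∈ Ioc 0 S := ⟨hsS.1.trans htS.1, htS.2.le⟩
  rw [← hNe t mt, ← hNe s ms, ht htS]
  congr 1
  refine intervalIntegral.integral_congr_ae ?_
  filter_upwards [eU, eΓ] with r r1 r2 hrm
  rw [uIoc_of_le htS.1.le] at hrm
  have mr : r ∈ Ioc 0 S := ⟨hsS.1.trans hrm.1, hrm.2.trans mt.2⟩
  rw [r1 mr, r2 mr]

theorem ae_normH_sq_sub_eq {d : ℕ} {Ω : Set (E d)} {g : ℝ → V' Ω} {u : ℝ → V Ω} {w : ℝ → H Ω}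
    {S : ℝ} (hu : MemLp u 2 (volume.restrict (Ioc 0 S)))
    (hg : MemLp g 2 (volume.restrict (Ioc 0 S)))
    (hw : ∀ᵐ t ∂volume.restrict (Ioi 0), (w t : L2 Ω (E d)) = field (u t))
    (hwg : ∀ (v : V Ω) (s t : ℝ), 0 < s → s < t →
      inner ℝ (w t : L2 Ω (E d)) (field v) - inner ℝ (w s : L2 Ω (E d)) (field v) =
        ∫ r in s..t, g r v) :
    ∀ᵐ s, s ∈ Ioo 0 S → ∀ᵐ t, t ∈ Ioo s S →
      normH (u t) ^ 2 - normH (u s) ^ 2 = 2 * ∫ r in s..t, g r (u r) :=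
  ae_norm_sq_sub_eq_integral_duality (fieldL Ω) (w := fun t => (w t : L2 Ω (E d))) hu hg hw hwg

section Plane

variable {Ω : Set (E 2)} {ν : ℝ → ℝ} {νup : ℝ} {f g : ℝ → V' Ω} {u : ℝ → V Ω} {w : ℝ → H Ω}

/-- A countable dense set of v, available by `secondCountable_V`, makes the null set independent of
v; both sides are continuous in v. Hence v = u(t) may be inserted. -/
theorem ae_forall_equation
    (h : ∀ v : V Ω, ∀ᵐ t ∂volume.restrict (Ioi (0 : ℝ)),
      g t v + ν t * a (u t) v + b (u t) (u t) v = f t v) :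
    ∀ᵐ t ∂volume.restrict (Ioi (0 : ℝ)), ∀ v : V Ω,
      g t v + ν t * a (u t) v + b (u t) (u t) v = f t v := by
  obtain ⟨D, hDc, hD⟩ := TopologicalSpace.exists_countable_dense (V Ω)
  filter_upwards [(ae_ball_iff hDc).2 fun v _ => h v] with t ht v
  refine hD.induction (P := fun v => g t v + ν t * a (u t) v + b (u t) (u t) v = f t v)
    (fun v hv => ht v hv) ?_ v
  exact isClosed_eq (((g t).continuous.add (continuous_const.mul (continuous_a_right _))).add
    (continuous_b_right _ _)) (f t).continuous

/-- In dimension two, the time derivative of a weak solution is square integrable. -/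
theorem memLp_timeDeriv {S M : ℝ} (h0 : ∀ t ∈ Ioi (0 : ℝ), 0 ≤ ν t)
    (hup : ∀ t ∈ Ioi (0 : ℝ), ν t ≤ νup) (hf : MemLp f 2 (volume.restrict (Ioc 0 S)))
    (hu : MemLp u 2 (volume.restrict (Ioc 0 S)))
    (hM : ∀ᵐ t ∂volume.restrict (Ioc 0 S), normH (u t) ≤ M)
    (hg : LocallyIntegrableOn g (Ioi 0))
    (h : ∀ᵐ t ∂volume.restrict (Ioi (0 : ℝ)), ∀ v : V Ω,
      g t v + ν t * a (u t) v + b (u t) (u t) v = f t v) :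
    MemLp g 2 (volume.restrict (Ioc 0 S)) := by
  obtain ⟨K, hK0, hK⟩ := exists_abs_b_self_le Ω
  -- The equation expresses g through f, the viscous term and b; as ‖u‖_H ≤ M, all are dominated by
  -- ‖f‖ plus a multiple of ‖u‖.
  refine MemLp.of_le (g := fun t => ‖f t‖ + (νup + K * M) * ‖u t‖)
    (hf.norm.add (hu.norm.const_mul _))
    (hg.aestronglyMeasurable.mono_set Ioc_subset_Ioi_self) ?_
  filter_upwards [hM, ae_restrict_mem measurableSet_Ioc,
    ae_restrict_of_ae_restrict_of_subset Ioc_subset_Ioi_self h] with t hMt ht heq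
  refine le_trans ?_ (le_abs_self _)
  have hM0 : 0 ≤ M := (normH_nonneg _).trans hMt
  have hν0 := h0 t ht.1
  have hνu := hup t ht.1
  have hνup : 0 ≤ νup := hν0.trans hνu
  refine ContinuousLinearMap.opNorm_le_bound _ (by positivity) fun v => ?_
  have e : g t v = f t v - ν t * a (u t) v - b (u t) (u t) v := by linarith [heq v]
  have h1 : |f t v| ≤ ‖f t‖ * ‖v‖ := (f t).le_opNorm v
  have h2 : |ν t * a (u t) v| ≤ νup * (‖u t‖ * ‖v‖) := by
    rw [abs_mul, abs_of_nonneg hν0]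
    exact mul_le_mul hνu (abs_a_le _ _) (abs_nonneg _) hνup
  have h3 : |b (u t) (u t) v| ≤ K * (M * ‖u t‖) * ‖v‖ := by
    refine (hK (u t) v).trans ?_
    gcongr
  rw [Real.norm_eq_abs, e]
  calc _ ≤ |f t v| + |ν t * a (u t) v| + |b (u t) (u t) v| :=
        (abs_sub _ _).trans (add_le_add_left (abs_sub _ _) _)
    _ ≤ ‖f t‖ * ‖v‖ + νup * (‖u t‖ * ‖v‖) + K * (M * ‖u t‖) * ‖v‖ :=
        add_le_add (add_le_add h1 h2) h3
    _ = _ := by ring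

/-- In dimension two, every weak solution satisfies the energy inequality. -/
theorem energyInequality_of_isWeakSolution {u₀ : H Ω} (hν : ∀ S, IntegrableOn ν (Ioc 0 S))
    (h0 : ∀ t ∈ Ioi (0 : ℝ), 0 ≤ ν t) (hup : ∀ t ∈ Ioi (0 : ℝ), ν t ≤ νup)
    (hf : ∀ S : ℝ, MemLp f 2 (volume.restrict (Ioc 0 S))) (hu : IsWeakSolution Ω ν f u₀ u) :
    EnergyInequality ν f u := by
  obtain ⟨w, hw, hwb, hwc, -⟩ := hu.weakCont
  obtain ⟨g, hg, hgd, heq⟩ := hu.equation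
  have heq' := ae_forall_equation heq
  have key : ∀ n : ℕ, ∀ᵐ s, s ∈ Ioo (0 : ℝ) n → ∀ᵐ t, t ∈ Ioo s (n : ℝ) →
      normH (u t) ^ 2 - normH (u s) ^ 2 = 2 * ∫ r in s..t, g r (u r) := by
    intro n
    obtain ⟨M, hM⟩ := hwb n
    have hM' : ∀ᵐ t ∂volume.restrict (Ioc 0 (n : ℝ)), normH (u t) ≤ M := by
      filter_upwards [ae_restrict_of_ae_restrict_of_subset Ioc_subset_Ioi_self hw,
        ae_restrict_mem measurableSet_Ioc] with t ht htm
      rw [normH, ← ht]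
      exact hM t ⟨htm.1.le, htm.2⟩
    exact ae_normH_sq_sub_eq (hu.memLp n)
      (memLp_timeDeriv h0 hup (hf n) (hu.memLp n) hM' hg heq') hw
      fun v s t hs hst => inner_sub_eq_integral hw hwc hg hgd v hs hst
  have key' := ae_all_iff.2 key
  refine (ae_restrict_iff' measurableSet_Ioi).2 ?_
  filter_upwards [key'] with s hs hs0
  have hs' : ∀ᵐ t, ∀ n : ℕ, s < n → t ∈ Ioo s (n : ℝ) →
      normH (u t) ^ 2 - normH (u s) ^ 2 = 2 * ∫ r in s..t, g r (u r) :=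
    ae_all_iff.2 fun n => by
      by_cases hsn : s < n
      · filter_upwards [hs n ⟨hs0, hsn⟩] with t ht _ using ht
      · exact ae_of_all _ fun t h => absurd h hsn
  refine (ae_restrict_iff' measurableSet_Ioi).2 ?_
  filter_upwards [hs'] with t ht hst
  obtain ⟨n, hn⟩ := exists_nat_gt t
  have e := ht n (lt_trans hst hn) ⟨hst, hn⟩
  have hst' : s ≤ t := le_of_lt hst
  have ht0 : (0 : ℝ) ≤ t := (le_of_lt hs0).trans hst'
  have i1 := intervalIntegrable_of_integrableOn_Ioc
    (fun S => integrableOn_duality (hf S) (hu.memLp S)) (le_of_lt hs0) ht0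
  have i2 := intervalIntegrable_of_integrableOn_Ioc
    (fun S => integrableOn_viscosity_mul (hν S) h0 hup (integrableOn_normV_sq (hu.memLp S)))
    (le_of_lt hs0) ht0
  -- The equation tested with u itself, where b(u, u, u) = 0.
  have e2 : ∫ r in s..t, g r (u r) =
      (∫ r in s..t, f r (u r)) - ∫ r in s..t, ν r * normV (u r) ^ 2 := by
    rw [← intervalIntegral.integral_sub i1 i2]
    refine intervalIntegral.integral_congr_ae ?_
    filter_upwards [(ae_restrict_iff' measurableSet_Ioi).1 heq'] with r hr hrm
    rw [uIoc_of_le hst'] at hrm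
    have := hr (lt_trans hs0 hrm.1) (u r)
    rw [b_self, a_self] at this
    linarith
  rw [e2] at e
  linarith

end Plane

/-! ### The averaged bound and the passage to the limsup of the force -/

theorem limsup_average_le_of_energyInequality {d : ℕ} (hd : d = 2 ∨ d = 3) {Ω : Set (E d)}
    (hΩb : Bornology.IsBounded Ω) {ν : ℝ → ℝ} {νlow νup c T : ℝ}
    (hν : ∀ S, IntegrableOn ν (Ioc 0 S)) (hpos : 0 < νlow)
    (hlow : ∀ t ∈ Ioi (0 : ℝ), νlow ≤ ν t) (hup : ∀ t ∈ Ioi (0 : ℝ), ν t ≤ νup)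
    (hc0 : 0 < c) (hc : poincareConst Ω ≤ c) {f : ℝ → V' Ω} {u : ℝ → V Ω}
    (hf : ∀ S : ℝ, MemLp f 2 (volume.restrict (Ioc 0 S)))
    (hu : ∀ S : ℝ, MemLp u 2 (volume.restrict (Ioc 0 S)))
    (h : EnergyInequality ν f u) (hT : c ^ 2 / νlow ≤ T) {M : ℝ} (hM : 0 ≤ M)
    (hfM : ∀ᶠ t in atTop, normV' (f t) ^ 2 ≤ ENNReal.ofReal M) :
    limsup (fun t : ℝ => (ENNReal.ofReal T)⁻¹ *
        ∫⁻ τ in Ioc t (t + T), ENNReal.ofReal (normV (u τ) ^ 2)) atTop ≤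
      ENNReal.ofReal ((Kbar ν c * νlow + c ^ 2) / (νlow ^ 2 * c ^ 2)) * ENNReal.ofReal M := by
  have hT0 : 0 < T := lt_of_lt_of_le (by positivity) hT
  have hK := Kbar_nonneg hν hlow hpos hc0
  set A := (Kbar ν c * νlow + c ^ 2) / (νlow ^ 2 * c ^ 2) with hA
  have hA0 : 0 ≤ A := by positivity
  rw [← ENNReal.ofReal_mul hA0]
  refine ENNReal.le_of_forall_pos_le_add fun ε hε _ => ?_
  have hεT : 0 < T * (ε : ℝ) := mul_pos hT0 hε
  obtain ⟨t₀, ht₀⟩ := eventually_atTop.1 hfM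
  have hP : ∀ v : V Ω, normH v ^ 2 ≤ c ^ 2 * normV v ^ 2 := fun v => by
    rw [← mul_pow]
    exact pow_le_pow_left₀ (normH_nonneg v) (poincare hd hΩb hc v) 2
  have main := eventually_lintegral_le_of_energy_ineq (D := fun t => normV (u t) ^ 2)
    (y := fun t => normH (u t) ^ 2) (p := fun t => f t (u t)) (t₀ := max t₀ 0)
    hν hpos hlow hup hc0 hM (fun t => sq_nonneg _) (fun t => sq_nonneg _) (fun t => hP (u t))
    (fun S => integrableOn_normV_sq (hu S)) (fun S => integrableOn_normH_sq (hu S))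
    (fun S => integrableOn_duality (hf S) (hu S)) (le_max_right _ _)
    (fun t ht => sq_apply_le_of_normV'_sq_le hd hΩb hM
      (ht₀ t ((le_max_left _ _).trans (le_of_lt ht))) (u t)) hT0 h hεT
  refine limsup_le_of_le (h := ?_)
  filter_upwards [main] with t ht
  -- Here K̄/T ≤ K̄ νlow/c² because T ≥ c²/νlow.
  have hreal : T⁻¹ * (M / νlow ^ 2 * (Kbar ν c + T) + T * ε) ≤ A * M + ε := by
    have e1 : T⁻¹ * (M / νlow ^ 2 * (Kbar ν c + T) + T * ε) =
        M / νlow ^ 2 * (Kbar ν c * T⁻¹ + 1) + ε := by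
      field_simp
    have e2 : A * M = M / νlow ^ 2 * (Kbar ν c * (c ^ 2 / νlow)⁻¹ + 1) := by
      rw [hA]; field_simp
    rw [e1, e2]
    gcongr
  calc (ENNReal.ofReal T)⁻¹ * ∫⁻ τ in Ioc t (t + T), ENNReal.ofReal (normV (u τ) ^ 2)
      ≤ (ENNReal.ofReal T)⁻¹ *
        ENNReal.ofReal (M / νlow ^ 2 * (Kbar ν c + T) + T * ε) := by gcongr
    _ = ENNReal.ofReal (T⁻¹ * (M / νlow ^ 2 * (Kbar ν c + T) + T * ε)) := by
        rw [← ENNReal.ofReal_inv_of_pos hT0, ← ENNReal.ofReal_mul (by positivity)]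
    _ ≤ ENNReal.ofReal (A * M + ε) := ENNReal.ofReal_le_ofReal hreal
    _ = ENNReal.ofReal (A * M) + ε := by
        rw [ENNReal.ofReal_add (by positivity) ε.coe_nonneg, ENNReal.ofReal_coe_nnreal]

end NSE

end

theorem lemma4p2 (d : ℕ) (hd : d = 2 ∨ d = 3)
    (Ω : Set (NSE.E d)) (hΩo : IsOpen Ω) (hΩb : Bornology.IsBounded Ω) (hΩn : Ω.Nonempty)
    (ν : ℝ → ℝ) (hν : ∀ S : ℝ, IntegrableOn ν (Ioo 0 S))
    (νlow νup : ℝ) (hlow : IsGLB (ν '' Ioi 0) νlow) (hup : IsLUB (ν '' Ioi 0) νup)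
    (hpos : 0 < νlow)
    (cρ : ℝ) (hc0 : 0 < cρ) (hc : NSE.poincareConst Ω ≤ cρ)
    (f : ℝ → NSE.V' Ω) (hf : ∀ S : ℝ, MemLp f 2 (volume.restrict (Ioc 0 S)))
    (u₀ : NSE.H Ω) (u : ℝ → NSE.V Ω) (hu : NSE.IsWeakSolution Ω ν f u₀ u)
    (henergy : d = 3 → NSE.EnergyInequality ν f u)
    (T : ℝ) (hT : cρ ^ 2 / νlow ≤ T) :
    limsup (fun t : ℝ => (ENNReal.ofReal T)⁻¹ *
        ∫⁻ τ in Ioc t (t + T), ENNReal.ofReal (NSE.normV (u τ) ^ 2)) atTop ≤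
      ENNReal.ofReal ((NSE.Kbar ν cρ * νlow + cρ ^ 2) / (νlow ^ 2 * cρ ^ 2)) *
        limsup (fun t : ℝ => NSE.normV' (f t) ^ 2) atTop := by
  have hν' : ∀ S, IntegrableOn ν (Ioc 0 S) := fun S =>
    (hν (S + 1)).mono_set fun t ht => ⟨ht.1, by linarith [ht.2]⟩
  have hlow' : ∀ t ∈ Ioi (0 : ℝ), νlow ≤ ν t := fun t ht => hlow.1 (mem_image_of_mem ν ht)
  have hup' : ∀ t ∈ Ioi (0 : ℝ), ν t ≤ νup := fun t ht => hup.1 (mem_image_of_mem ν ht)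
  have hE : NSE.EnergyInequality ν f u := by
    rcases hd with rfl | rfl
    · exact NSE.energyInequality_of_isWeakSolution hν'
        (fun t ht => hpos.le.trans (hlow' t ht)) hup' hf hu
    · exact henergy rfl
  have hK := NSE.Kbar_nonneg hν' hlow' hpos hc0
  set F := limsup (fun t : ℝ => NSE.normV' (f t) ^ 2) atTop with hF
  have hA0 : 0 < (NSE.Kbar ν cρ * νlow + cρ ^ 2) / (νlow ^ 2 * cρ ^ 2) := by positivity
  -- The constant is positive, so an infinite limsup makes the right side infinite.
  rcases eq_or_ne F ⊤ with hFt | hFt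
  · rw [hFt, ENNReal.mul_top (by simpa using hA0)]
    exact le_top
  have key : ∀ ε : NNReal, 0 < ε → limsup (fun t : ℝ => (ENNReal.ofReal T)⁻¹ *
        ∫⁻ τ in Ioc t (t + T), ENNReal.ofReal (NSE.normV (u τ) ^ 2)) atTop ≤
      ENNReal.ofReal ((NSE.Kbar ν cρ * νlow + cρ ^ 2) / (νlow ^ 2 * cρ ^ 2)) * (F + ε) := by
    intro ε hε
    -- A strict excess over the limsup is an eventual bound for the force, so F + ε can play the
    -- role of M.
    have hlt : F < F + ε := ENNReal.lt_add_right hFt (by simpa using hε.ne')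
    have hFε : F + ε = ENNReal.ofReal (F + ε).toReal :=
      (ENNReal.ofReal_toReal (by simp [hFt])).symm
    rw [hFε]
    refine NSE.limsup_average_le_of_energyInequality hd hΩb hν' hpos hlow' hup' hc0 hc hf
      hu.memLp hE hT ENNReal.toReal_nonneg ?_
    rw [← hFε]
    exact (eventually_lt_of_limsup_lt hlt).mono fun t ht => ht.le
  have hlim : Tendsto (fun ε : NNReal => ENNReal.ofReal ((NSE.Kbar ν cρ * νlow + cρ ^ 2) /
      (νlow ^ 2 * cρ ^ 2)) * (F + ε)) (𝓝[>] 0)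
      (𝓝 (ENNReal.ofReal ((NSE.Kbar ν cρ * νlow + cρ ^ 2) / (νlow ^ 2 * cρ ^ 2)) * F)) := by
    have h1 : Tendsto (fun ε : NNReal => F + (ε : ℝ≥0∞)) (𝓝[>] 0) (𝓝 (F + (0 : NNReal))) :=
      (tendsto_const_nhds.add (ENNReal.continuous_coe.tendsto 0)).mono_left nhdsWithin_le_nhds
    rw [ENNReal.coe_zero, add_zero] at h1
    exact ENNReal.Tendsto.const_mul h1 (Or.inr ENNReal.ofReal_ne_top)
  refine ge_of_tendsto hlim ?_
  filter_upwards [self_mem_nhdsWithin] with ε hε using key ε hε
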